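/- **Setting.** Let $\Sigma=\{a,b\}$ and $[n]=\{1,\dots,n\}$. An $n$-state transition structure is a map $\mathcal A=\delta:[n]\times\Sigma\to[n]$, extended to words by $\delta(x,\varepsilon)=x$, $\delta(x,v\alpha)=\delta(\delta(x,v),\alpha)$. Let $u_0=\varepsilon,u_1=a,u_2=b,u_3=aa,\dots$ be the words over $\Sigma$ in length-lexicographic order, and $[\![x,y]\!]=[x,y]\cap\mathbb Z$. A template $\mathcal T$ assigns to every transition $(x,\alpha)\in[n]\times\Sigma$ a non-empty set $\mathcal T(x,\alpha)\subseteq[n]$; $\mathcal A\models\mathcal T$ means $\delta(x,\alpha)\in\mathcal T(x,\alpha)$ for all $(x,\alpha)$. Put $h=\lceil\log_2\sqrt n\,\rceil$, and let $d_1,d_2>0$ and an integer $d\ge1$ be given. *Backward templates $\mathbf B_n(p)$.* For a transition structure $\delta$ and $p\in[n]$ let $d_p^-(x)\in\{0,1,\dots,\infty\}$ be the length of a shortest path from $x$ to $p$, $L_t=\{x:d_p^-(x)=t\}$, and $S=L_0\cup\dots\cup L_h$. If $|S|\le d_1\sqrt n$ and $|L_h|\ge d_2\sqrt n$, then $\mathbf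 B_n(p)$ contains the template $\mathcal T$ with $\mathcal T(x,\alpha)=\{\delta(x,\alpha)\}$ if $x\in S$ and $d_p^-(\delta(x,\alpha))=d_p^-(x)-1$; $\mathcal T(x,\alpha)=[n]\setminus\bigcup_{k<d_p^-(x)}L_k$ for the other $(x,\alpha)$ with $x\in S$; and $\mathcal T(x,\alpha)=[n]\setminus\bigcup_{k<h}L_k$ if $x\notin S$. *Cycle templates $\mathbf C_n(p)$.* Let $\mathcal A_0=\delta_0$ satisfy $\mathcal T_0\in\mathbf B_n(p)$, with its sets $S$ and $L_h$, and let $r_j=\delta_0(p,au_j)$. The forward process of $\mathcal A_0$ succeeds at step $i$ if $i<\lceil\sqrt n\,\rceil$, $r_i\in L_h$, and $r_0,\dots,r_{i-1}$ are pairwise distinct and not in $S$. Then $\mathbf C_n(p)$ contains the template $\hat{\mathcal T}$ obtained from $\mathcal T_0$ by replacing by $\{\delta_0(x,\alpha)\}$ the set of each explored transition $(x,\alpha)$, that is, of $(p,a)$ and of all $(r_j,\alpha)$ with $j<i$ and $u_j\alpha\in\{u_0,\dots,u_i\}$. Its cycle support is $K=S\cup\{r_0,\dots,r_{i-1}\}$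 and its word is $w=u_iv$, where $v$ is the length-lexicographically smallest word with $\delta_0(r_i,v)=p$; so $aw$ labels a cycle around $p$. *Thread templates $\mathbf T_n(p,q)$.* Let $\hat{\mathcal T}\in\mathbf C_n(p)$ with cycle support $K$ and word $w$, and let $u=w(aw)^{d-1}$. Let $x_0=q,x_1,\dots,x_{|u|}$ be pairwise distinct states outside $K$; put $X=\{x_0,\dots,x_{|u|}\}$. Let $p_{0,1}=p$ and $p_{i,1}=x_{i|aw|-1}$ for $1\le i\le d$. Let $\lambda_0,\dots,\lambda_d$ be integers with $2\sqrt n\le\lambda_i\le3\sqrt n$, and let $p_{i,j}$ ($0\le i\le d$, $2\le j\le\lambda_i$) be states outside $K\cup X$ such that all the $p_{i,j}$ ($0\le i\le d$, $1\le j\le\lambda_i$) are pairwise distinct. Put $E_i=\{p_{i,j}:1\le j\le\lambda_i\}$. Then $\mathbf T_n(p,q)$ contains the template $\mathcal T$ obtained from $\hat{\mathcal T}$ by resetting $\mathcal T(x_{k},u^{(k+1)})=\{x_{k+1}\}$ for $0\le k<|u|$, where $u^{(k+1)}$ is the $(k+1)$-st letter of $u$; $\mathcal T(p_{i,j},b)=\{p_{i,j+1}\}$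 for $1\le j<\lambda_i$; and $\mathcal T(p_{i,\lambda_i},b)=E_i$. *Cycle lengths.* A transition structure $\mathcal A=\delta$ satisfies at most one $\mathcal T\in\mathbf T_n(p,q)$. If it satisfies one, then $\delta(p_{i,\lambda_i},b)=p_{i,j_i}$ for some $j_i$, and the $i$-th $b$-thread ends in a $b$-cycle of length $\ell_i=\lambda_i-j_i+1$. Let $\ell(\mathcal A,p,q)=(\ell_0,\dots,\ell_d)$ if $\mathcal A$ satisfies a template of $\mathbf T_n(p,q)$ and all the $\ell_i$ are in $[\![\sqrt n,2\sqrt n\,]\!]$, and $\ell(\mathcal A,p,q)=\bot$ otherwise. **Proposition.** There are constants $d_1,d_2>0$ such that, for every integer $d\ge1$, there exists $c_\ell>0$ such that for all sufficiently large $n$ and all $p\in[n]$: if $q$ is uniform in $[n]$ and $\mathcal A$ is a uniform $n$-state transition structure independent of $q$, then $$\mathbb P\big(\ell(\mathcal A,p,q)\ne\bot\big)\ge c_\ell .$$ Moreover, conditioned on $\ell(\mathcal A,p,q)\ne\bot$, the random variables $\ell_0,\dots,\ell_d$ are independent and uniform on $[\![\sqrt n,2\sqrt n\,]\!]$. -/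

import Mathlib

open MeasureTheory ProbabilityTheory

noncomputable section

namespace RandomAutomaton

/-- The two-letter alphabet `{a, b}`, ordered by `a < b`. -/
abbrev Letter : Type := Bool

/-- The letter `a`. -/
abbrev la : Letter := false

/-- The letter `b`. -/
abbrev lb : Letter := true

/-- A deterministic complete transition structure with `n` states over `{a, b}`. -/
abbrev TransStruct (n : ℕ) : Type := Fin n → Letter → Fin n

variable {n : ℕ}

/-- The state `δ(x, w)` reached from `x` by reading the word `w`. -/
def run (A : TransStruct n) (x : Fin n) (w : List Letter) : Fin n := w.foldl A x

/-- The sequence `u_0 = ε, u_1 = a, u_2 = b, u_3 = aa, …` of all words in length-lexicographic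
order: the words `u_j a` and `u_j b` have indices `2 j + 1` and `2 j + 2`. -/
def wordAt : ℕ → List Letter
  | 0 => []
  | k + 1 => wordAt (k / 2) ++ [if k % 2 = 0 then la else lb]
decreasing_by omega

/-! ### Templates -/

/-- A template: a non-empty set of allowed targets for every transition. -/
structure Template (n : ℕ) where
  allowed : Fin n → Letter → Set (Fin n)
  nonempty : ∀ x α, (allowed x α).Nonempty

/-- `A` satisfies the template `T`. -/
def Satisfies (A : TransStruct n) (T : Template n) : Prop :=
  ∀ x α, A x α ∈ T.allowed x α

/-! ### The backward substructure from `p` -/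

/-- Backward distance from `p` to `x`: the length of a shortest path from `x` to `p`
(`⊤` if there is none). -/
def backDist (A : TransStruct n) (p x : Fin n) : ℕ∞ :=
  ⨅ (w : List Letter) (_ : run A x w = p), (w.length : ℕ∞)

/-- The backward layer `L_t`. -/
def layer (A : TransStruct n) (p : Fin n) (t : ℕ) : Set (Fin n) :=
  {x | backDist A p x = t}

/-- The backward support `L_0 ∪ ⋯ ∪ L_h`. -/
def support (A : TransStruct n) (p : Fin n) (h : ℕ) : Set (Fin n) :=
  {x | ∃ t ≤ h, x ∈ layer A p t}

/-- The depth `h = ⌈log₂ √n⌉`. -/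
def depth (n : ℕ) : ℕ := ⌈Real.logb 2 (Real.sqrt n)⌉₊

open Classical in
/-- The partial transition function of the `h`-backward substructure of `A` from `p`. -/
def backSub (A : TransStruct n) (p : Fin n) (h : ℕ) (x : Fin n) (α : Letter) :
    Option (Fin n) :=
  if backDist A p x ≤ h ∧ backDist A p (A x α) + 1 = backDist A p x then some (A x α) else none

open Classical in
/-- The allowed targets in the template associated to the `h`-backward substructure of `A`. -/
def backAllowed (A : TransStruct n) (p : Fin n) (h : ℕ) (x : Fin n) (α : Letter) :
    Set (Fin n) :=
  match backSub A p h x α with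
  | some y => {y}
  | none =>
    if x ∈ support A p h then {y | ¬ ∃ k : ℕ, (k : ℕ∞) < backDist A p x ∧ y ∈ layer A p k}
    else {y | ¬ ∃ k : ℕ, k < h ∧ y ∈ layer A p k}

/-- The set `B_n(p)` of templates associated to the backward substructures of depth
`⌈log₂ √n⌉` from `p` with at most `d₁ √n` states, at least `d₂ √n` of them in the last layer. -/
def backTemplates (d₁ d₂ : ℝ) (p : Fin n) : Set (Template n) :=
  {T | ∃ A : TransStruct n,
    ((support A p (depth n)).ncard : ℝ) ≤ d₁ * Real.sqrt n ∧
    d₂ * Real.sqrt n ≤ ((layer A p (depth n)).ncard : ℝ) ∧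
    ∀ x α, T.allowed x α = backAllowed A p (depth n) x α}

/-! ### The forward process from `p` -/

/-- The state `r_i = δ(p, a u_i)`. -/
def fwdState (A : TransStruct n) (p : Fin n) (i : ℕ) : Fin n := run A p (la :: wordAt i)

/-- The forward process does not halt at step `j`. -/
def FwdContinues (A : TransStruct n) (p : Fin n) (j : ℕ) : Prop :=
  fwdState A p j ∉ support A p (depth n) ∧
  (∀ k < j, fwdState A p j ≠ fwdState A p k) ∧
  j ≠ ⌈Real.sqrt n⌉₊

/-- The forward process halts at step `i` with a success, i.e. before the step `⌈√n⌉` and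
because `r_i` is in the last backward layer. -/
def FwdSuccess (A : TransStruct n) (p : Fin n) (i : ℕ) : Prop :=
  (∀ j < i, FwdContinues A p j) ∧ i ≠ ⌈Real.sqrt n⌉₊ ∧ fwdState A p i ∈ layer A p (depth n)

/-- The transition `(x, α)` is explored by the forward process of `A` up to step `i`: it is
`(p, a)`, or `(r_j, α)` with `j < i` and `u_j α ∈ {u_0, …, u_i}`. -/
def FwdExplored (A : TransStruct n) (p : Fin n) (i : ℕ) (x : Fin n) (α : Letter) : Prop :=
  (x = p ∧ α = la) ∨
  ∃ j < i, x = fwdState A p j ∧ ∃ k ≤ i, wordAt k = wordAt j ++ [α]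

/-- `T` is the template of `C_n(p)` associated to `A`, where `A` satisfies a template `T₀` of
`B_n(p)` and has a forward process that halts with a success at step `i`: `T₀` with all the
transitions explored by the forward process forced. -/
def IsCycleTemplate (d₁ d₂ : ℝ) (p : Fin n) (A : TransStruct n) (i : ℕ) (T : Template n) :
    Prop :=
  FwdSuccess A p i ∧
  ∃ T₀ ∈ backTemplates d₁ d₂ p, Satisfies A T₀ ∧
    ∀ x α, (FwdExplored A p i x α → T.allowed x α = {A x α}) ∧
      (¬ FwdExplored A p i x α → T.allowed x α = T₀.allowed x α)

/-- The cycle support: the backward support and the states `r_j`, `j < i`. -/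
def cycleSupport (A : TransStruct n) (p : Fin n) (i : ℕ) : Set (Fin n) :=
  support A p (depth n) ∪ {x | ∃ j < i, x = fwdState A p j}

/-- `w = u_i v` with `v` the length-lexicographically smallest word that labels a path from
`r_i` to `p`; then `a w` labels a cycle around `p`. -/
def IsCycleWord (A : TransStruct n) (p : Fin n) (i : ℕ) (w : List Letter) : Prop :=
  ∃ v : List Letter, w = wordAt i ++ v ∧ run A (fwdState A p i) v = p ∧
    ∀ v' : List Letter, run A (fwdState A p i) v' = p → v' ≠ v →
      List.Shortlex (· < ·) v v'

/-! ### The path from `q`, the `b`-threads and the `b`-cycles -/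

/-- The word `w (a w)^(d-1)`. -/
def pathWord (d : ℕ) (w : List Letter) : List Letter :=
  w ++ (List.replicate (d - 1) (la :: w)).flatten

/-- `T` is a template of `T_n(p, q)` with `b`-thread lengths `lam 0, …, lam d`, whose `i`-th
`b`-thread is `P i 0 → P i 1 → ⋯ → P i (lam i - 1)` (numbered from `0`). -/
def IsThreadTemplate (d₁ d₂ : ℝ) (d : ℕ) (p q : Fin n) (T : Template n)
    (lam : Fin (d + 1) → ℕ) (P : Fin (d + 1) → ℕ → Fin n) : Prop :=
  ∃ (C : Template n) (A₀ : TransStruct n) (i₀ : ℕ) (w : List Letter) (x : ℕ → Fin n),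
    -- the template `C` of `C_n(p)` on which `T` is built, and its word `w`
    IsCycleTemplate d₁ d₂ p A₀ i₀ C ∧ IsCycleWord A₀ p i₀ w ∧
    -- the path `x 0 → x 1 → ⋯` from `q`, labeled by `w (a w)^(d-1)`
    x 0 = q ∧
    (∀ k ≤ (pathWord d w).length, x k ∉ cycleSupport A₀ p i₀) ∧
    (∀ k ≤ (pathWord d w).length, ∀ l ≤ (pathWord d w).length, x k = x l → k = l) ∧
    -- the starting states of the `b`-threads: `p`, then the states of the path reached after
    -- reading `w (a w)^(i-1)`
    P 0 0 = p ∧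
    (∀ i : Fin (d + 1), i ≠ 0 → P i 0 = x ((i : ℕ) * (w.length + 1) - 1)) ∧
    -- the lengths of the `b`-threads
    (∀ i, 2 * Real.sqrt n ≤ lam i ∧ (lam i : ℝ) ≤ 3 * Real.sqrt n) ∧
    -- their states are new and pairwise distinct
    (∀ i j, 1 ≤ j → j < lam i →
      P i j ∉ cycleSupport A₀ p i₀ ∧ ∀ k ≤ (pathWord d w).length, P i j ≠ x k) ∧
    (∀ i j i' j', j < lam i → j' < lam i' → P i j = P i' j' → i = i' ∧ j = j') ∧
    -- the allowed targets
    (∀ k α, (pathWord d w)[k]? = some α → T.allowed (x k) α = {x (k + 1)}) ∧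
    (∀ i j, j + 1 < lam i → T.allowed (P i j) lb = {P i (j + 1)}) ∧
    (∀ i, T.allowed (P i (lam i - 1)) lb = {y | ∃ j < lam i, y = P i j}) ∧
    (∀ y α, (¬ ∃ k, y = x k ∧ (pathWord d w)[k]? = some α) →
      (¬ ∃ i j, j < lam i ∧ y = P i j ∧ α = lb) → T.allowed y α = C.allowed y α)

/-- The set `T_n(p, q)` of templates. -/
def threadTemplates (d₁ d₂ : ℝ) (d : ℕ) (p q : Fin n) : Set (Template n) :=
  {T | ∃ lam P, IsThreadTemplate d₁ d₂ d p q T lam P}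

/-- `A` satisfies a template of `T_n(p, q)` and the lengths of the `b`-cycles that end its
`b`-threads are `l 0, …, l d`: the `i`-th `b`-thread cycles back from its last state
`P i (lam i - 1)` to `P i j`, where `l i = lam i - j`. -/
def IsLoopTuple (d₁ d₂ : ℝ) (d : ℕ) (A : TransStruct n) (p q : Fin n)
    (l : Fin (d + 1) → ℕ) : Prop :=
  ∃ T lam P, IsThreadTemplate d₁ d₂ d p q T lam P ∧ Satisfies A T ∧
    ∀ i, ∃ j < lam i, A (P i (lam i - 1)) lb = P i j ∧ l i = lam i - j

/-- The integers between `√n` and `2 √n`. -/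
def loopRange (n : ℕ) : Set ℕ := {m | Real.sqrt n ≤ m ∧ (m : ℝ) ≤ 2 * Real.sqrt n}

open Classical in
/-- `ℓ(A, p, q)`: the tuple of the lengths of the `b`-cycles if `A` satisfies a template of
`T_n(p, q)` (there is at most one such template, and the tuple is unique) and all these lengths
are between `√n` and `2 √n`, and `none` (for `⊥`) otherwise. -/
def loopLengths (d₁ d₂ : ℝ) (d : ℕ) (A : TransStruct n) (p q : Fin n) :
    Option (Fin (d + 1) → ℕ) :=
  if h : ∃ l, IsLoopTuple d₁ d₂ d A p q l ∧ ∀ i, l i ∈ loopRange n then some h.choose else none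

/-- The `i`-th `b`-cycle length (with the dummy value `0` where `ℓ(A, p, q) = ⊥`). -/
def loopLength (d₁ d₂ : ℝ) (d : ℕ) (A : TransStruct n) (p q : Fin n) (i : Fin (d + 1)) : ℕ :=
  (loopLengths d₁ d₂ d A p q).getD (fun _ => 0) i

/-- The law of `(q, A)`: `q` is a uniform state, `A` is a uniform `n`-state transition structure,
and they are independent. -/
def randomPair (n : ℕ) : Measure (Fin n × TransStruct n) :=
  (uniformOn (Set.univ : Set (Fin n))).prod (uniformOn (Set.univ : Set (TransStruct n)))

/-- The event `ℓ(A, p, q) ≠ ⊥`. -/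
def successEvent (d₁ d₂ : ℝ) (d : ℕ) (p : Fin n) : Set (Fin n × TransStruct n) :=
  {ω | loopLengths d₁ d₂ d ω.2 p ω.1 ≠ none}

end RandomAutomaton

end

namespace RandomAutomaton

variable {n : ℕ}

/-! ### Backward balls -/

/-! The law of the cycle lengths follows from a symmetry, and the lower bound from a moment
computation followed by a count.

Symmetry. The pair (q, A) determines the path, the threads and the cycle lengths
(`IsThreadTemplate.unique`): the backward substructure fixes the step at which the forward process
stops and the word w, then reading w (a w)^(d-1) from q and powers of b from the branching states
fixes the rest. Redirecting the last transition of every thread to another state of the same thread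
therefore maps the pairs with one admissible tuple of cycle lengths injectively to the pairs with
any other (`ncard_loopLengths_le`). Since (q, A) is uniform, all tuples in the box have the same
weight, which gives independence and uniformity (`iIndepFun_and_map_of_ncard_eq`).

Lower bound, backward part. Given the backward balls up to radius t, each state outside the ball of
radius t chooses its two transitions independently and uniformly outside the ball of radius t - 1.
The layers thus grow like a branching process with mean offspring 2, up to a loss of order |ball|^2
/ n. At depth h, where 2^h lies between √n and 2 √n, the accumulated loss is bounded; the
Paley-Zygmund and Markov inequalities give a backward substructure of the right size with
probability at least 1/64 (`card_transStruct_le_card_goodBack`).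

Lower bound, forward part. Fix the number i of forward steps, the thread lengths and the cycle
lengths. In a good structure, choose r_i in the last layer and k = O(√n) distinct fresh states
outside the backward ball, and overwrite k + d + 1 transitions so that they run through these
states. This is injective once the overwritten values are recorded
(`card_sigma_le_card_threadPairs`), so at least (M/64) (√n/4) (n - K √n)^k / n^(k+d+1) pairs have
the given lengths, where M is the number of structures. Avoiding collisions costs only the factor (1
- K/√n)^k ≥ exp (-2 K^2). There are at least √n (n/4)^(d+1) choices of lengths, with disjoint sets
of pairs, so the total is a constant fraction of n M. -/

/-- The states at backward distance at most `t` from `p`. -/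
def ball (A : TransStruct n) (p : Fin n) : ℕ → Finset (Fin n)
  | 0 => {p}
  | t + 1 => ball A p t ∪ Finset.univ.filter fun x => ∃ α, A x α ∈ ball A p t

theorem mem_ball_zero {A : TransStruct n} {p x : Fin n} : x ∈ ball A p 0 ↔ x = p := by
  simp [ball]

theorem mem_ball_succ {A : TransStruct n} {p x : Fin n} {t : ℕ} :
    x ∈ ball A p (t + 1) ↔ x ∈ ball A p t ∨ ∃ α, A x α ∈ ball A p t := by
  simp only [ball, Finset.mem_union, Finset.mem_filter, Finset.mem_univ, true_and]

theorem ball_mono (A : TransStruct n) (p : Fin n) : Monotone (ball A p) :=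
  monotone_nat_of_le_succ fun _ _ hx => mem_ball_succ.2 (Or.inl hx)

theorem self_mem_ball (A : TransStruct n) (p : Fin n) (t : ℕ) : p ∈ ball A p t :=
  ball_mono A p t.zero_le (mem_ball_zero.2 rfl)

theorem mem_ball_iff {A : TransStruct n} {p x : Fin n} {t : ℕ} :
    x ∈ ball A p t ↔ ∃ w : List Letter, w.length ≤ t ∧ run A x w = p := by
  induction t generalizing x with
  | zero => simp [mem_ball_zero, run]
  | succ t ih =>
    rw [mem_ball_succ]
    constructor
    · rintro (h | ⟨α, h⟩)
      · obtain ⟨w, hw, hr⟩ := ih.1 h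
        exact ⟨w, hw.trans t.le_succ, hr⟩
      · obtain ⟨w, hw, hr⟩ := ih.1 h
        exact ⟨α :: w, by simpa using hw, hr⟩
    · rintro ⟨w, hw, hr⟩
      cases w with
      | nil => exact Or.inl (ih.2 ⟨[], by simp, hr⟩)
      | cons α w => exact Or.inr ⟨α, ih.2 ⟨w, by simpa using hw, hr⟩⟩

theorem backDist_le_iff {A : TransStruct n} {p x : Fin n} {t : ℕ} :
    backDist A p x ≤ t ↔ x ∈ ball A p t := by
  constructor
  · intro h
    by_contra hx
    have h1 : ((t + 1 : ℕ) : ℕ∞) ≤ backDist A p x := by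
      refine le_iInf₂ fun w hw => ?_
      by_contra hlt
      exact hx (mem_ball_iff.2 ⟨w, Nat.lt_succ_iff.1 (by exact_mod_cast not_le.1 hlt), hw⟩)
    have h2 : t + 1 ≤ t := by exact_mod_cast h1.trans h
    omega
  · intro h
    obtain ⟨w, hw, hr⟩ := mem_ball_iff.1 h
    exact (iInf₂_le w hr).trans (by exact_mod_cast hw)

theorem mem_support_iff {A : TransStruct n} {p x : Fin n} {h : ℕ} :
    x ∈ support A p h ↔ x ∈ ball A p h := by
  rw [← backDist_le_iff]
  constructor
  · rintro ⟨t, ht, hx⟩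
    exact (show backDist A p x = t from hx).le.trans (by exact_mod_cast ht)
  · intro hx
    obtain ⟨t, ht⟩ := ENat.ne_top_iff_exists.1 (ne_top_of_le_ne_top (ENat.natCast_ne_top h) hx)
    exact ⟨t, by rw [← ht] at hx; exact_mod_cast hx, ht.symm⟩

theorem mem_layer_iff {A : TransStruct n} {p x : Fin n} {t : ℕ} :
    x ∈ layer A p t ↔ x ∈ ball A p t ∧ ∀ s < t, x ∉ ball A p s := by
  simp only [layer, Set.mem_ofPred_eq, ← backDist_le_iff, not_le]
  constructor
  · intro h
    rw [h]
    exact ⟨le_rfl, fun s hs => by exact_mod_cast hs⟩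
  · rintro ⟨h1, h2⟩
    obtain ⟨s, hs⟩ := ENat.ne_top_iff_exists.1 (ne_top_of_le_ne_top (ENat.natCast_ne_top t) h1)
    rw [← hs] at h1 h2 ⊢
    have h3 : s ≤ t := by exact_mod_cast h1
    rcases h3.lt_or_eq with h4 | h4
    · exact absurd (h2 s h4) (lt_irrefl _)
    · rw [h4]

theorem coe_ball (A : TransStruct n) (p : Fin n) (h : ℕ) :
    (ball A p h : Set (Fin n)) = support A p h :=
  Set.ext fun _ => mem_support_iff.symm

theorem mem_layer_succ {A : TransStruct n} {p x : Fin n} {t : ℕ} :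
    x ∈ layer A p (t + 1) ↔ x ∈ ball A p (t + 1) ∧ x ∉ ball A p t := by
  rw [mem_layer_iff]
  refine and_congr_right fun _ => ⟨fun h => h t t.lt_succ_self, fun h s hs hx => h ?_⟩
  exact ball_mono A p (Nat.lt_succ_iff.1 hs) hx

theorem layer_subset_support {A : TransStruct n} {p : Fin n} {t : ℕ} :
    layer A p t ⊆ support A p t := fun _ hx => ⟨t, le_rfl, hx⟩

theorem self_mem_support (A : TransStruct n) (p : Fin n) (h : ℕ) : p ∈ support A p h :=
  mem_support_iff.2 (self_mem_ball A p h)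

/-- The backward balls of `A'` are those of `A` if these satisfy the recursion of `A'`. -/
theorem ball_eq_of_forall {A A' : TransStruct n} {p : Fin n} {t : ℕ}
    (H : ∀ s < t, ∀ x, x ∈ ball A p (s + 1) ↔ x ∈ ball A p s ∨ ∃ α, A' x α ∈ ball A p s) :
    ∀ s ≤ t, ball A' p s = ball A p s := by
  intro s
  induction s with
  | zero => intro _; rfl
  | succ s ih =>
    intro hs
    ext x
    rw [mem_ball_succ, ih (by omega), H s (by omega)]

/-- `A` and `A'` have the same backward substructure of depth `h` from `p`. -/
def SameBack (A A' : TransStruct n) (p : Fin n) (h : ℕ) : Prop :=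
  ∀ s < h, ∀ x, x ∉ ball A p s → ∀ α,
    (A x α ∈ ball A p s ∨ A' x α ∈ ball A p s) → A' x α = A x α

theorem SameBack.ball_eq {A A' : TransStruct n} {p : Fin n} {h : ℕ} (H : SameBack A A' p h) :
    ∀ s ≤ h, ball A' p s = ball A p s := by
  refine ball_eq_of_forall fun s hs x => ?_
  rw [mem_ball_succ]
  by_cases hx : x ∈ ball A p s
  · simp [hx]
  · simp only [hx, false_or]
    exact exists_congr fun α => ⟨fun h => (H s hs x hx α (Or.inl h)).symm ▸ h,
      fun h => (H s hs x hx α (Or.inr h)) ▸ h⟩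

/-- The definition mentions the balls of the first structure only; symmetry holds because the balls
coincide. -/
theorem SameBack.symm {A A' : TransStruct n} {p : Fin n} {h : ℕ} (H : SameBack A A' p h) :
    SameBack A' A p h := by
  intro s hs x hx α hα
  rw [H.ball_eq s hs.le] at hx hα
  exact (H s hs x hx α hα.symm).symm

theorem SameBack.trans {A A' A'' : TransStruct n} {p : Fin n} {h : ℕ} (H : SameBack A A' p h)
    (H' : SameBack A' A'' p h) : SameBack A A'' p h := by
  intro s hs x hx α hα
  have hx' : x ∉ ball A' p s := by rwa [H.ball_eq s hs.le]
  have key := H' s hs x hx' α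
  rw [H.ball_eq s hs.le] at key
  rcases hα with h1 | h1
  · have h2 := H s hs x hx α (Or.inl h1)
    rw [key (Or.inl (h2 ▸ h1)), h2]
  · have h2 := key (Or.inr h1)
    rw [h2, H s hs x hx α (Or.inr (h2 ▸ h1))]

theorem SameBack.support_eq {A A' : TransStruct n} {p : Fin n} {h : ℕ}
    (H : SameBack A A' p h) : support A' p h = support A p h := by
  rw [← coe_ball, ← coe_ball, H.ball_eq h le_rfl]

theorem SameBack.layer_eq {A A' : TransStruct n} {p : Fin n} {h t : ℕ}
    (H : SameBack A A' p h) (ht : t ≤ h) : layer A' p t = layer A p t := by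
  ext x
  rw [mem_layer_iff, mem_layer_iff, H.ball_eq t ht]
  exact and_congr_right fun _ => forall₂_congr fun s hs => by rw [H.ball_eq s (hs.le.trans ht)]

/-! ### Backward templates and equality of backward substructures. -/

theorem mem_backAllowed_self (A : TransStruct n) (p : Fin n) (h : ℕ) (x : Fin n) (α : Letter) :
    A x α ∈ backAllowed A p h x α := by
  unfold backAllowed backSub
  by_cases hc : backDist A p x ≤ h ∧ backDist A p (A x α) + 1 = backDist A p x
  · simp [hc]
  · simp only [if_neg hc]
    by_cases hx : x ∈ support A p h
    · rw [if_pos hx]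
      rintro ⟨k, hk, hl⟩
      apply hc
      have hx' := backDist_le_iff.2 (mem_support_iff.1 hx)
      refine ⟨hx', ?_⟩
      rw [show backDist A p (A x α) = k from hl]
      refine le_antisymm (Order.add_one_le_of_lt hk) ?_
      have : x ∈ ball A p (k + 1) :=
        mem_ball_succ.2 (Or.inr ⟨α, (mem_layer_iff.1 hl).1⟩)
      exact_mod_cast backDist_le_iff.2 this
    · rw [if_neg hx]
      rintro ⟨k, hk, hl⟩
      apply hx
      rw [mem_support_iff]
      exact ball_mono A p hk (mem_ball_succ.2 (Or.inr ⟨α, (mem_layer_iff.1 hl).1⟩))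

theorem mem_layer_of_mem_ball {A : TransStruct n} {p x : Fin n} {t : ℕ} (hx : x ∈ ball A p t) :
    ∃ k ≤ t, x ∈ layer A p k :=
  mem_support_iff.2 hx

/-- In `A`, a transition that enters a ball of radius s < h from outside lies on a shortest path,
hence is forced by the template. Any other transition of `A'` into that ball would have a target in
a layer that the template forbids. -/
theorem sameBack_of_mem_backAllowed {A A' : TransStruct n} {p : Fin n} {h : ℕ}
    (H : ∀ x α, A' x α ∈ backAllowed A p h x α) : SameBack A A' p h := by
  intro s hs x hx α hα
  have hxα := H x α
  unfold backAllowed backSub at hxα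
  by_cases hc : backDist A p x ≤ h ∧ backDist A p (A x α) + 1 = backDist A p x
  · simpa [hc] using hxα
  · simp only [if_neg hc] at hxα
    exfalso
    rcases hα with hα | hα
    · apply hc
      have h1 : x ∈ ball A p (s + 1) := mem_ball_succ.2 (Or.inr ⟨α, hα⟩)
      have h2 : x ∈ layer A p (s + 1) := mem_layer_succ.2 ⟨h1, hx⟩
      obtain ⟨k, hk, hl⟩ := mem_layer_of_mem_ball hα
      have hks : k = s := by
        by_contra hne
        refine hx (ball_mono A p (show k + 1 ≤ s by omega)
          (mem_ball_succ.2 (Or.inr ⟨α, (mem_layer_iff.1 hl).1⟩)))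
      subst hks
      rw [show backDist A p x = ((k + 1 : ℕ) : ℕ∞) from h2,
        show backDist A p (A x α) = k from hl]
      exact ⟨by exact_mod_cast hs, by push_cast; rfl⟩
    · obtain ⟨k, hk, hl⟩ := mem_layer_of_mem_ball hα
      split_ifs at hxα with hx'
      · refine hxα ⟨k, ?_, hl⟩
        rw [← not_le, backDist_le_iff]
        exact fun h' => hx (ball_mono A p hk h')
      · exact hxα ⟨k, by omega, hl⟩

theorem backAllowed_of_notMem {A : TransStruct n} {p x : Fin n} {h : ℕ} (hx : x ∉ support A p h)
    (α : Letter) {y : Fin n} (hy : y ∉ support A p h) : y ∈ backAllowed A p h x α := by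
  have hc : ¬ (backDist A p x ≤ h ∧ backDist A p (A x α) + 1 = backDist A p x) := fun hc =>
    hx (mem_support_iff.2 (backDist_le_iff.1 hc.1))
  simp only [backAllowed, backSub, if_neg hc, if_neg hx]
  rintro ⟨k, hk, hl⟩
  exact hy ⟨k, hk.le, hl⟩

theorem mem_backAllowed_root {A : TransStruct n} {p : Fin n} {h : ℕ} (α : Letter) (y : Fin n) :
    y ∈ backAllowed A p h p α := by
  have h0 : backDist A p p = 0 := by
    have := backDist_le_iff.2 (self_mem_ball A p 0)
    simpa using this
  have hc : ¬ (backDist A p p ≤ h ∧ backDist A p (A p α) + 1 = backDist A p p) := by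
    rw [h0]; simp
  simp [backAllowed, backSub, self_mem_support, h0]

/-! ### The forward process and the cycle word -/

/-- The last letter of the word of index `k + 1`. -/
def lastLetter (k : ℕ) : Letter := if k % 2 = 0 then la else lb

theorem wordAt_succ (k : ℕ) : wordAt (k + 1) = wordAt (k / 2) ++ [lastLetter k] := by
  rw [wordAt]; rfl

theorem run_append (A : TransStruct n) (x : Fin n) (v w : List Letter) :
    run A x (v ++ w) = run A (run A x v) w := by
  simp [run]

theorem fwdState_zero (A : TransStruct n) (p : Fin n) : fwdState A p 0 = A p la := by
  simp [fwdState, run, wordAt]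

theorem fwdState_succ (A : TransStruct n) (p : Fin n) (k : ℕ) :
    fwdState A p (k + 1) = A (fwdState A p (k / 2)) (lastLetter k) := by
  rw [fwdState, wordAt_succ, ← List.cons_append, run_append]
  rfl

theorem fwdState_eq {A : TransStruct n} {p : Fin n} {i : ℕ} {r : ℕ → Fin n}
    (h0 : A p la = r 0) (hs : ∀ k < i, A (r (k / 2)) (lastLetter k) = r (k + 1)) :
    ∀ k ≤ i, fwdState A p k = r k := by
  intro k
  induction k using Nat.strong_induction_on with
  | _ k ih =>
    intro hk
    cases k with
    | zero => rw [fwdState_zero, h0]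
    | succ k => rw [fwdState_succ, ih (k / 2) (by omega) (by omega), hs k (by omega)]

theorem SameBack.fwdSuccess {A A' : TransStruct n} {p : Fin n} {i : ℕ}
    (H : SameBack A A' p (depth n)) (hr : ∀ k ≤ i, fwdState A' p k = fwdState A p k)
    (hA : FwdSuccess A p i) : FwdSuccess A' p i := by
  obtain ⟨h1, h2, h3⟩ := hA
  refine ⟨fun j hj => ?_, h2, by rwa [hr i le_rfl, H.layer_eq le_rfl]⟩
  obtain ⟨h4, h5, h6⟩ := h1 j hj
  refine ⟨by rwa [hr j hj.le, H.support_eq], fun k hk => ?_, h6⟩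
  rw [hr j hj.le, hr k (hk.le.trans hj.le)]
  exact h5 k hk

/-- A word that reaches `p` in as few letters as the distance permits must enter a smaller ball at
every letter, so it reads only transitions of the backward substructure. -/
theorem SameBack.run_eq {A A' : TransStruct n} {p : Fin n} {h : ℕ} (H : SameBack A A' p h)
    (v : List Letter) : ∀ {y : Fin n}, v.length ≤ h → (∀ t < v.length, y ∉ ball A p t) →
      run A y v = p → run A' y v = p := by
  induction v with
  | nil => intro y _ _ hr; exact hr
  | cons α v ih =>
    intro y hv hy hr
    have hr' : run A (A y α) v = p := hr
    have hm : A y α ∈ ball A p v.length := mem_ball_iff.2 ⟨v, le_rfl, hr'⟩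
    have he : A' y α = A y α := H v.length (by simpa using hv) y (hy _ (by simp)) α (Or.inl hm)
    change run A' (A' y α) v = p
    rw [he]
    refine ih (by simp at hv; omega) (fun t ht hmem => ?_) hr'
    exact hy (t + 1) (by simpa using ht) (mem_ball_succ.2 (Or.inr ⟨α, hmem⟩))

/-- `v` is the length-lexicographically smallest word from `y` to `p`. -/
def IsMinWord (A : TransStruct n) (p y : Fin n) (v : List Letter) : Prop :=
  run A y v = p ∧ ∀ v' : List Letter, run A y v' = p → v' ≠ v → List.Shortlex (· < ·) v v'

theorem isCycleWord_iff {A : TransStruct n} {p : Fin n} {i : ℕ} {w : List Letter} :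
    IsCycleWord A p i w ↔ ∃ v, w = wordAt i ++ v ∧ IsMinWord A p (fwdState A p i) v := Iff.rfl

theorem IsMinWord.unique {A : TransStruct n} {p y : Fin n} {v v' : List Letter}
    (h : IsMinWord A p y v) (h' : IsMinWord A p y v') : v = v' := by
  by_contra hne
  exact Std.Asymm.asymm (r := List.Shortlex (α := Letter) (· < ·)) _ _
    (h.2 v' h'.1 (Ne.symm hne)) (h'.2 v h.1 hne)

theorem IsMinWord.length_eq {A : TransStruct n} {p y : Fin n} {v : List Letter} {h : ℕ}
    (hv : IsMinWord A p y v) (hy : y ∈ layer A p h) : v.length = h := by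
  rw [mem_layer_iff] at hy
  apply le_antisymm
  · obtain ⟨w, hw, hr⟩ := mem_ball_iff.1 hy.1
    by_cases hne : w = v
    · rwa [← hne]
    · have := List.shortlex_def.1 (hv.2 w hr hne)
      omega
  · by_contra hlt
    exact hy.2 _ (not_le.1 hlt) (mem_ball_iff.2 ⟨v, le_rfl, hv.1⟩)

theorem exists_isMinWord {A : TransStruct n} {p y : Fin n} {h : ℕ} (hy : y ∈ ball A p h) :
    ∃ v, IsMinWord A p y v := by
  have hwf : WellFounded (List.Shortlex (α := Letter) (· < ·)) := List.Shortlex.wf wellFounded_lt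
  obtain ⟨w, _, hr⟩ := mem_ball_iff.1 hy
  obtain ⟨v, hv, hmin⟩ := hwf.has_min {v | run A y v = p} ⟨w, hr⟩
  refine ⟨v, hv, fun v' hv' hne => ?_⟩
  by_contra hns
  exact hne (Std.Trichotomous.trichotomous (r := List.Shortlex (α := Letter) (· < ·)) _ _
    (hmin v' hv') hns)

/-- From the last layer no word shorter than h reaches `p`, and the words of length h that do so are
the same in both structures. The minimum is thus taken over the same candidates. -/
theorem SameBack.isMinWord {A A' : TransStruct n} {p y : Fin n} {h : ℕ} (H : SameBack A A' p h)
    (hy : y ∈ layer A p h) {v : List Letter} (hv : IsMinWord A p y v) : IsMinWord A' p y v := by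
  have hl := hv.length_eq hy
  have hy' : y ∈ layer A' p h := by rwa [H.layer_eq le_rfl]
  refine ⟨H.run_eq v hl.le (fun t ht => (mem_layer_iff.1 hy).2 t (hl ▸ ht)) hv.1,
    fun v' hv' hne => ?_⟩
  have hge : h ≤ v'.length := by
    by_contra hlt
    exact (mem_layer_iff.1 hy').2 _ (not_le.1 hlt) (mem_ball_iff.2 ⟨v', le_rfl, hv'⟩)
  rcases hge.lt_or_eq with hlt | heq
  · exact List.Shortlex.of_length_lt (hl ▸ hlt)
  · exact hv.2 v' (H.symm.run_eq v' heq.ge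
      (fun t ht => (mem_layer_iff.1 hy').2 t (heq ▸ ht)) hv') hne

theorem IsCycleWord.unique {A : TransStruct n} {p : Fin n} {i : ℕ} {w w' : List Letter}
    (h : IsCycleWord A p i w) (h' : IsCycleWord A p i w') : w = w' := by
  obtain ⟨v, rfl, hv⟩ := isCycleWord_iff.1 h
  obtain ⟨v', rfl, hv'⟩ := isCycleWord_iff.1 h'
  rw [hv.unique hv']

theorem SameBack.isCycleWord {A A' : TransStruct n} {p : Fin n} {i : ℕ} {w : List Letter}
    (H : SameBack A A' p (depth n)) (hr : fwdState A' p i = fwdState A p i)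
    (hi : FwdSuccess A p i) (hw : IsCycleWord A p i w) : IsCycleWord A' p i w := by
  obtain ⟨v, rfl, hv⟩ := isCycleWord_iff.1 hw
  exact isCycleWord_iff.2 ⟨v, rfl, hr ▸ H.isMinWord hi.2.2 hv⟩

theorem FwdSuccess.unique {A : TransStruct n} {p : Fin n} {i i' : ℕ} (h : FwdSuccess A p i)
    (h' : FwdSuccess A p i') : i = i' := by
  by_contra hne
  rcases Nat.lt_or_gt_of_ne hne with hlt | hlt
  · exact (h'.1 i hlt).1 (layer_subset_support h.2.2)
  · exact (h.1 i' hlt).1 (layer_subset_support h'.2.2)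

/-! ### Threads that end in cycles -/

/-- `P 0, …, P (lam - 1)` is the orbit of `P 0` under `f`, and it ends in a cycle of length `l`. -/
structure IsRho {α : Type*} (f : α → α) (P : ℕ → α) (lam l : ℕ) : Prop where
  step : ∀ j, j + 1 < lam → f (P j) = P (j + 1)
  inj : ∀ j j', j < lam → j' < lam → P j = P j' → j = j'
  pos : 1 ≤ l
  le : l ≤ lam
  close : f (P (lam - 1)) = P (lam - l)

theorem IsRho.eq_iterate {α : Type*} {f : α → α} {P : ℕ → α} {lam l : ℕ} (h : IsRho f P lam l) :
    ∀ j < lam, P j = f^[j] (P 0) := by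
  intro j
  induction j with
  | zero => intro _; rfl
  | succ j ih =>
    intro hj
    rw [Function.iterate_succ_apply', ← ih (by omega), h.step j hj]

/-- A longer `P'` would contain f^lam (P 0), which is the earlier state f^(lam - l) (P 0), against
its injectivity. -/
theorem IsRho.length_le {α : Type*} {f : α → α} {P P' : ℕ → α} {lam lam' l l' : ℕ}
    (h : IsRho f P lam l) (h' : IsRho f P' lam' l') (h0 : P 0 = P' 0) : lam' ≤ lam := by
  by_contra hlt
  have hpos := h.pos
  have hle := h.le
  have e : P' lam = P' (lam - l) := by
    rw [h'.eq_iterate lam (by omega), h'.eq_iterate (lam - l) (by omega), ← h0,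
      ← h.eq_iterate (lam - l) (by omega), ← h.close, h.eq_iterate (lam - 1) (by omega),
      ← Function.iterate_succ_apply' f, show (lam - 1).succ = lam by omega]
  have := h'.inj _ _ (by omega) (by omega) e
  omega

theorem IsRho.unique {α : Type*} {f : α → α} {P P' : ℕ → α} {lam lam' l l' : ℕ}
    (h : IsRho f P lam l) (h' : IsRho f P' lam' l') (h0 : P 0 = P' 0) :
    lam = lam' ∧ l = l' ∧ ∀ j < lam, P j = P' j := by
  obtain rfl : lam = lam' := le_antisymm (h'.length_le h h0.symm) (h.length_le h' h0)
  have hP : ∀ j < lam, P j = P' j := fun j hj => by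
    rw [h.eq_iterate j hj, h'.eq_iterate j hj, h0]
  have h1 := h.pos
  have h2 := h.le
  have h3 := h'.pos
  have h4 := h'.le
  refine ⟨rfl, ?_, hP⟩
  have e : P (lam - l) = P (lam - l') := by
    rw [← h.close, hP (lam - 1) (by omega), h'.close, hP (lam - l') (by omega)]
  have := h.inj _ _ (by omega) (by omega) e
  omega

theorem length_pathWord {d : ℕ} (hd : 1 ≤ d) (w : List Letter) :
    (pathWord d w).length + 1 = d * (w.length + 1) := by
  obtain ⟨d, rfl⟩ := Nat.exists_eq_add_of_le' hd
  simp [pathWord]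
  ring

theorem index_le_length_pathWord {d : ℕ} (hd : 1 ≤ d) (w : List Letter) (i : Fin (d + 1)) :
    (i : ℕ) * (w.length + 1) - 1 ≤ (pathWord d w).length := by
  have h1 := length_pathWord hd w
  have h2 : (i : ℕ) * (w.length + 1) ≤ d * (w.length + 1) :=
    Nat.mul_le_mul_right _ (Nat.lt_succ_iff.1 i.2)
  omega

/-- The path `x` from `q` labeled by `w (a w)^(d-1)` in `A`, and the `b`-threads `P i`, with their
lengths and the lengths of their cycles. -/
structure IsThreadPath (d : ℕ) (A : TransStruct n) (p q : Fin n) (w : List Letter)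
    (lam l : Fin (d + 1) → ℕ) (x : ℕ → Fin n) (P : Fin (d + 1) → ℕ → Fin n) : Prop where
  start : x 0 = q
  step : ∀ k α, (pathWord d w)[k]? = some α → A (x k) α = x (k + 1)
  root : P 0 0 = p
  branch : ∀ i : Fin (d + 1), i ≠ 0 → P i 0 = x ((i : ℕ) * (w.length + 1) - 1)
  rho : ∀ i, IsRho (fun y => A y lb) (P i) (lam i) (l i)

theorem IsThreadPath.path_eq {d : ℕ} {A : TransStruct n} {p q : Fin n} {w : List Letter}
    {lam l lam' l' : Fin (d + 1) → ℕ} {x x' : ℕ → Fin n} {P P' : Fin (d + 1) → ℕ → Fin n}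
    (h : IsThreadPath d A p q w lam l x P) (h' : IsThreadPath d A p q w lam' l' x' P') :
    ∀ k ≤ (pathWord d w).length, x k = x' k := by
  intro k
  induction k with
  | zero => intro _; rw [h.start, h'.start]
  | succ k ih =>
    intro hk
    have hw : (pathWord d w)[k]? = some (pathWord d w)[k] := List.getElem?_eq_getElem hk
    rw [← h.step k _ hw, ← h'.step k _ hw, ih (by omega)]

theorem IsThreadPath.unique {d : ℕ} (hd : 1 ≤ d) {A : TransStruct n} {p q : Fin n}
    {w : List Letter} {lam l lam' l' : Fin (d + 1) → ℕ} {x x' : ℕ → Fin n}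
    {P P' : Fin (d + 1) → ℕ → Fin n} (h : IsThreadPath d A p q w lam l x P)
    (h' : IsThreadPath d A p q w lam' l' x' P') :
    lam = lam' ∧ l = l' ∧ ∀ i, ∀ j < lam i, P i j = P' i j := by
  have key : ∀ i, lam i = lam' i ∧ l i = l' i ∧ ∀ j < lam i, P i j = P' i j := by
    intro i
    refine (h.rho i).unique (h'.rho i) ?_
    by_cases hi : i = 0
    · rw [hi, h.root, h'.root]
    · rw [h.branch i hi, h'.branch i hi]
      exact h.path_eq h' _ (index_le_length_pathWord hd w i)
  exact ⟨funext fun i => (key i).1, funext fun i => (key i).2.1, fun i => (key i).2.2⟩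

/-- The conditions on the backward substructure and the forward process of `A`. -/
structure IsCore (d₁ d₂ : ℝ) (A : TransStruct n) (p : Fin n) (i : ℕ) (w : List Letter) : Prop where
  card_support : ((support A p (depth n)).ncard : ℝ) ≤ d₁ * Real.sqrt n
  card_layer : d₂ * Real.sqrt n ≤ ((layer A p (depth n)).ncard : ℝ)
  success : FwdSuccess A p i
  word : IsCycleWord A p i w

theorem IsCore.unique {d₁ d₂ : ℝ} {A : TransStruct n} {p : Fin n} {i i' : ℕ} {w w' : List Letter}
    (h : IsCore d₁ d₂ A p i w) (h' : IsCore d₁ d₂ A p i' w') : i = i' ∧ w = w' := by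
  obtain rfl := h.success.unique h'.success
  exact ⟨rfl, h.word.unique h'.word⟩

theorem one_le_sqrt_of_state (p : Fin n) : (1 : ℝ) ≤ Real.sqrt n := by
  rw [Real.one_le_sqrt]
  exact_mod_cast p.pos

theorem two_le_of_two_mul_sqrt_le (p : Fin n) {m : ℕ} (h : 2 * Real.sqrt n ≤ m) : 2 ≤ m := by
  have h1 := one_le_sqrt_of_state p
  have h2 : (2 : ℝ) ≤ m := by linarith
  exact_mod_cast h2

/-! ### Transitions left free by cycle templates, and recovery of the core. -/

theorem mem_cycleSupport_of_fwdExplored {A : TransStruct n} {p : Fin n} {i : ℕ} {x : Fin n}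
    {α : Letter} (h : FwdExplored A p i x α) : x ∈ cycleSupport A p i := by
  rcases h with ⟨rfl, _⟩ | ⟨j, hj, hx, _⟩
  · exact Or.inl (self_mem_support A x _)
  · exact Or.inr ⟨j, hj, hx⟩

/-- With the next lemma, this shows that the transitions reset by a thread template were already
compatible with the underlying cycle template, as long as they do not return to the cycle support.
-/
theorem IsCycleTemplate.mem_allowed {d₁ d₂ : ℝ} {p : Fin n} {A : TransStruct n} {i : ℕ}
    {C : Template n} (h : IsCycleTemplate d₁ d₂ p A i C) {y : Fin n} (α : Letter) {z : Fin n}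
    (hy : y ∉ cycleSupport A p i) (hz : z ∉ cycleSupport A p i) : z ∈ C.allowed y α := by
  obtain ⟨_, T₀, ⟨A₁, _, _, hT₀⟩, hA, hC⟩ := h
  have hs : SameBack A₁ A p (depth n) := sameBack_of_mem_backAllowed fun x α => hT₀ x α ▸ hA x α
  rw [(hC y α).2 fun he => hy (mem_cycleSupport_of_fwdExplored he), hT₀]
  apply backAllowed_of_notMem <;> rw [← hs.support_eq] <;> intro hmem
  · exact hy (Or.inl hmem)
  · exact hz (Or.inl hmem)

/-- No state is closer to `p` than `p` itself, so the backward template leaves the transitions of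
`p` free; the forward process explores only the letter a at `p`, because the states r_j avoid the
support. -/
theorem IsCycleTemplate.mem_allowed_root {d₁ d₂ : ℝ} {p : Fin n} {A : TransStruct n} {i : ℕ}
    {C : Template n} (h : IsCycleTemplate d₁ d₂ p A i C) (z : Fin n) : z ∈ C.allowed p lb := by
  obtain ⟨hi, T₀, ⟨A₁, _, _, hT₀⟩, hA, hC⟩ := h
  rw [(hC p lb).2, hT₀]
  · exact mem_backAllowed_root _ _
  · rintro (⟨_, h⟩ | ⟨j, hj, hx, _⟩)
    · exact absurd h (by decide)
    · exact (hi.1 j hj).1 (hx ▸ self_mem_support A p _)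

/-- A structure that satisfies a cycle template has the same backward substructure and the same
forward process as the structure from which the template was built. -/
theorem IsCycleTemplate.isCore {d₁ d₂ : ℝ} {p : Fin n} {A A' : TransStruct n} {i : ℕ}
    {C : Template n} {w : List Letter} (h : IsCycleTemplate d₁ d₂ p A i C)
    (hw : IsCycleWord A p i w) (hA' : Satisfies A' C) : IsCore d₁ d₂ A' p i w := by
  obtain ⟨hi, T₀, ⟨A₁, h1, h2, hT₀⟩, hA, hC⟩ := h
  have hs : SameBack A₁ A p (depth n) := sameBack_of_mem_backAllowed fun x α => hT₀ x α ▸ hA x α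
  have he : ∀ x α, FwdExplored A p i x α → A' x α = A x α := fun x α hx => by
    have := hA' x α
    rwa [(hC x α).1 hx] at this
  have hs' : SameBack A₁ A' p (depth n) := by
    refine sameBack_of_mem_backAllowed fun x α => ?_
    rw [← hT₀ x α]
    by_cases hx : FwdExplored A p i x α
    · rw [he x α hx]
      exact hA x α
    · rw [← (hC x α).2 hx]
      exact hA' x α
  have hAA' := hs.symm.trans hs'
  have hr : ∀ k ≤ i, fwdState A' p k = fwdState A p k := by
    refine fwdState_eq ?_ fun k hk => ?_
    · rw [he p la (Or.inl ⟨rfl, rfl⟩), fwdState_zero]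
    · rw [he, fwdState_succ]
      exact Or.inr ⟨k / 2, by omega, rfl, k + 1, hk, wordAt_succ k⟩
  exact ⟨by rwa [hs'.support_eq], by rwa [hs'.layer_eq le_rfl], hAA'.fwdSuccess hr hi,
    hAA'.isCycleWord (hr i le_rfl) hi hw⟩

open Classical in
/-- `A`, with the transition from `s` labeled by `b` redirected to `s` if it leads to `p`. -/
noncomputable def openLoop (A : TransStruct n) (p s : Fin n) : TransStruct n :=
  fun y α => if y = s ∧ α = lb ∧ A y α = p then y else A y α

theorem openLoop_of_ne {A : TransStruct n} {p s y : Fin n} {α : Letter} (h : A y α ≠ p) :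
    openLoop A p s y α = A y α := if_neg fun h' => h h'.2.2

theorem IsThreadTemplate.two_le {d₁ d₂ : ℝ} {d : ℕ} {p q : Fin n} {T : Template n}
    {lam : Fin (d + 1) → ℕ} {P : Fin (d + 1) → ℕ → Fin n}
    (hT : IsThreadTemplate d₁ d₂ d p q T lam P) (i : Fin (d + 1)) : 2 ≤ lam i := by
  obtain ⟨C, A₀, i₀, w, x, -, -, -, -, -, -, -, hlam, -⟩ := hT
  exact two_le_of_two_mul_sqrt_le p (hlam i).1

theorem IsThreadTemplate.inj {d₁ d₂ : ℝ} {d : ℕ} {p q : Fin n} {T : Template n}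
    {lam : Fin (d + 1) → ℕ} {P : Fin (d + 1) → ℕ → Fin n}
    (hT : IsThreadTemplate d₁ d₂ d p q T lam P) :
    ∀ i j i' j', j < lam i → j' < lam i' → P i j = P i' j' → i = i' ∧ j = j' := by
  obtain ⟨C, A₀, i₀, w, x, -, -, -, -, -, -, -, -, -, hinj, -⟩ := hT
  exact hinj

/-- The thread template relaxes the cycle template at one point: the thread from `p` may close at
`p` itself, which adds an edge into `p` and can change the backward substructure. `openLoop` removes
this edge, and the resulting structure satisfies the cycle template, hence inherits its core. -/
theorem IsThreadTemplate.exists_core {d₁ d₂ : ℝ} {d : ℕ} (hd : 1 ≤ d) {p q : Fin n}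
    {T : Template n} {lam l : Fin (d + 1) → ℕ} {P : Fin (d + 1) → ℕ → Fin n}
    {A : TransStruct n} (hT : IsThreadTemplate d₁ d₂ d p q T lam P) (hA : Satisfies A T)
    (hl : ∀ i, ∃ j < lam i, A (P i (lam i - 1)) lb = P i j ∧ l i = lam i - j) :
    ∃ i₀ w x, IsCore d₁ d₂ (openLoop A p (P 0 (lam 0 - 1))) p i₀ w ∧
      IsThreadPath d A p q w lam l x P := by
  have hlam2 := hT.two_le
  have hinj := hT.inj
  obtain ⟨C, A₀, i₀, w, x, hC, hw, hx0, hxK, hxinj, hP0, hPi, hlam, hPK, -, hTx, hTP, hTc,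
    hTo⟩ := hT
  have hPK' : ∀ i j, j < lam i → (i = 0 → j ≠ 0) → P i j ∉ cycleSupport A₀ p i₀ := by
    intro i j hj h0
    by_cases hj0 : j = 0
    · subst hj0
      rw [hPi i fun hi => h0 hi rfl]
      exact hxK _ (index_le_length_pathWord hd w i)
    · exact (hPK i j (by omega) hj).1
  have hxs : ∀ k α, (pathWord d w)[k]? = some α → A (x k) α = x (k + 1) := fun k α hk => by
    have := hA (x k) α
    rwa [hTx k α hk] at this
  have hPs : ∀ i j, j + 1 < lam i → A (P i j) lb = P i (j + 1) := fun i j hj => by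
    have := hA (P i j) lb
    rwa [hTP i j hj] at this
  have hpK : p ∈ cycleSupport A₀ p i₀ := Or.inl (self_mem_support _ _ _)
  refine ⟨i₀, w, x, hC.isCore hw fun y α => ?_, hx0, hxs, hP0, hPi, fun i => ?_⟩
  · by_cases h1 : ∃ k, y = x k ∧ (pathWord d w)[k]? = some α
    · obtain ⟨k, rfl, hk⟩ := h1
      have hkl : k < (pathWord d w).length := (List.getElem?_eq_some_iff.1 hk).1
      have hn : x (k + 1) ∉ cycleSupport A₀ p i₀ := hxK _ hkl
      rw [openLoop_of_ne, hxs k α hk]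
      · exact hC.mem_allowed _ (hxK k hkl.le) hn
      · rw [hxs k α hk]
        exact fun h => hn (h ▸ hpK)
    · by_cases h2 : ∃ i j, j < lam i ∧ y = P i j ∧ α = lb
      · obtain ⟨i, j, hj, rfl, rfl⟩ := h2
        -- The transition (p, b) is the only reset transition whose source is in the cycle support;
        -- all its targets are allowed.
        by_cases h00 : i = 0 ∧ j = 0
        · obtain ⟨rfl, rfl⟩ := h00
          rw [hP0]
          exact hC.mem_allowed_root _
        have hyK := hPK' i j hj fun hi hj => h00 ⟨hi, hj⟩
        refine hC.mem_allowed _ hyK ?_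
        by_cases hjl : j + 1 < lam i
        · have hn := hPK' i (j + 1) hjl (fun _ => by omega)
          rw [openLoop_of_ne, hPs i j hjl]
          · exact hn
          · rw [hPs i j hjl]
            exact fun h => hn (h ▸ hpK)
        · obtain rfl : j = lam i - 1 := by omega
          obtain ⟨j', hj', hc, _⟩ := hl i
          -- If the thread from `p` closes at `p`, the opened structure has instead a loop at its
          -- last state, which is outside the cycle support.
          by_cases h00' : i = 0 ∧ j' = 0
          · obtain ⟨rfl, rfl⟩ := h00'
            rw [openLoop, if_pos ⟨rfl, rfl, hc.trans hP0⟩]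
            exact hyK
          · have hn := hPK' i j' hj' fun hi hj => h00' ⟨hi, hj⟩
            rw [openLoop_of_ne, hc]
            · exact hn
            · rw [hc]
              exact fun h => hn (h ▸ hpK)
      · rw [← hTo y α h1 h2, openLoop, if_neg]
        · exact hA y α
        · rintro ⟨rfl, rfl, _⟩
          exact h2 ⟨0, _, by have := hlam2 0; omega, rfl, rfl⟩
  · obtain ⟨j, hj, hc, hlj⟩ := hl i
    refine ⟨hPs i, fun j j' hj hj' h => (hinj i j i j' hj hj' h).2, by omega, by omega, ?_⟩
    rw [hc, hlj]
    congr 1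
    omega

/-- The thread lengths, the thread states and the cycle lengths are determined by `A` and `q`. -/
theorem IsThreadTemplate.unique {d₁ d₂ : ℝ} {d : ℕ} (hd : 1 ≤ d) {p q : Fin n}
    {T T' : Template n} {lam l lam' l' : Fin (d + 1) → ℕ} {P P' : Fin (d + 1) → ℕ → Fin n}
    {A : TransStruct n}
    (hT : IsThreadTemplate d₁ d₂ d p q T lam P) (hA : Satisfies A T)
    (hl : ∀ i, ∃ j < lam i, A (P i (lam i - 1)) lb = P i j ∧ l i = lam i - j)
    (hT' : IsThreadTemplate d₁ d₂ d p q T' lam' P') (hA' : Satisfies A T')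
    (hl' : ∀ i, ∃ j < lam' i, A (P' i (lam' i - 1)) lb = P' i j ∧ l' i = lam' i - j) :
    lam = lam' ∧ l = l' ∧ ∀ i, ∀ j < lam i, P i j = P' i j := by
  obtain ⟨i₀, w, x, hc, ht⟩ := hT.exists_core hd hA hl
  obtain ⟨i₀', w', x', hc', ht'⟩ := hT'.exists_core hd hA' hl'
  -- The thread from `p` depends on `A` only. Hence both templates open the same transition, and
  -- their cores are cores of the same structure.
  have h0 := (ht.rho 0).unique (ht'.rho 0) (ht.root.trans ht'.root.symm)
  have h2 := hT.two_le 0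
  rw [← h0.1, ← h0.2.2 (lam 0 - 1) (by omega)] at hc'
  obtain ⟨rfl, rfl⟩ := hc.unique hc'
  exact ht.unique hd ht'

theorem IsLoopTuple.unique {d₁ d₂ : ℝ} {d : ℕ} (hd : 1 ≤ d) {A : TransStruct n} {p q : Fin n}
    {l l' : Fin (d + 1) → ℕ} (h : IsLoopTuple d₁ d₂ d A p q l)
    (h' : IsLoopTuple d₁ d₂ d A p q l') : l = l' := by
  obtain ⟨T, lam, P, hT, hA, hl⟩ := h
  obtain ⟨T', lam', P', hT', hA', hl'⟩ := h'
  exact (hT.unique hd hA hl hT' hA' hl').2.1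

theorem loopLengths_eq_some_iff {d₁ d₂ : ℝ} {d : ℕ} (hd : 1 ≤ d) {A : TransStruct n} {p q : Fin n}
    {l : Fin (d + 1) → ℕ} :
    loopLengths d₁ d₂ d A p q = some l ↔
      IsLoopTuple d₁ d₂ d A p q l ∧ ∀ i, l i ∈ loopRange n := by
  unfold loopLengths
  split_ifs with h
  · rw [Option.some_inj]
    constructor
    · rintro rfl
      exact h.choose_spec
    · exact fun hl => h.choose_spec.1.unique hd hl.1
  · simp only [false_iff]
    exact fun hl => h ⟨l, hl⟩

/-! ### Changing the cycle lengths -/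

open Classical in
/-- `A` with the transitions labeled by `b` from the states `s i` redirected to `t i`. -/
noncomputable def redirect {ι : Type*} (A : TransStruct n) (s t : ι → Fin n) : TransStruct n :=
  fun y α => if h : α = lb ∧ ∃ i, y = s i then t h.2.choose else A y α

theorem redirect_apply {ι : Type*} {A : TransStruct n} {s t : ι → Fin n}
    (hs : Function.Injective s) (i : ι) : redirect A s t (s i) lb = t i := by
  have h : lb = lb ∧ ∃ j, s i = s j := ⟨rfl, i, rfl⟩
  rw [redirect, dif_pos h, ← hs h.2.choose_spec]

theorem redirect_of_ne {ι : Type*} {A : TransStruct n} {s t : ι → Fin n} {y : Fin n} {α : Letter}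
    (h : ¬ (α = lb ∧ ∃ i, y = s i)) : redirect A s t y α = A y α := dif_neg h

theorem IsThreadTemplate.end_injective {d₁ d₂ : ℝ} {d : ℕ} {p q : Fin n} {T : Template n}
    {lam : Fin (d + 1) → ℕ} {P : Fin (d + 1) → ℕ → Fin n}
    (hT : IsThreadTemplate d₁ d₂ d p q T lam P) :
    Function.Injective fun i => P i (lam i - 1) := fun i i' h =>
  (hT.inj i _ i' _ (by have := hT.two_le i; omega) (by have := hT.two_le i'; omega) h).1

theorem IsThreadTemplate.end_allowed {d₁ d₂ : ℝ} {d : ℕ} {p q : Fin n} {T : Template n}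
    {lam : Fin (d + 1) → ℕ} {P : Fin (d + 1) → ℕ → Fin n}
    (hT : IsThreadTemplate d₁ d₂ d p q T lam P) (i : Fin (d + 1)) :
    T.allowed (P i (lam i - 1)) lb = {y | ∃ j < lam i, y = P i j} := by
  obtain ⟨C, A₀, i₀, w, x, -, -, -, -, -, -, -, -, -, -, -, -, h, -⟩ := hT
  exact h i

theorem IsThreadTemplate.le_of_mem_loopRange {d₁ d₂ : ℝ} {d : ℕ} {p q : Fin n} {T : Template n}
    {lam : Fin (d + 1) → ℕ} {P : Fin (d + 1) → ℕ → Fin n}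
    (hT : IsThreadTemplate d₁ d₂ d p q T lam P) (i : Fin (d + 1)) {m : ℕ}
    (hm : m ∈ loopRange n) : 1 ≤ m ∧ m ≤ lam i := by
  obtain ⟨C, A₀, i₀, w, x, -, -, -, -, -, -, -, hlam, -⟩ := hT
  have h1 := (one_le_sqrt_of_state p).trans hm.1
  exact ⟨by exact_mod_cast h1, by exact_mod_cast hm.2.trans (hlam i).1⟩

theorem IsThreadTemplate.satisfies_redirect {d₁ d₂ : ℝ} {d : ℕ} {p q : Fin n} {T : Template n}
    {lam : Fin (d + 1) → ℕ} {P : Fin (d + 1) → ℕ → Fin n} {A : TransStruct n}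
    (hT : IsThreadTemplate d₁ d₂ d p q T lam P) (hA : Satisfies A T)
    {l : Fin (d + 1) → ℕ} (hl : ∀ i, 1 ≤ l i ∧ l i ≤ lam i) :
    Satisfies (redirect A (fun i => P i (lam i - 1)) fun i => P i (lam i - l i)) T := by
  intro y α
  by_cases h : α = lb ∧ ∃ i, y = P i (lam i - 1)
  · obtain ⟨rfl, i, rfl⟩ := h
    rw [redirect_apply (s := fun i => P i (lam i - 1)) hT.end_injective, hT.end_allowed]
    exact ⟨_, by have := hl i; omega, rfl⟩
  · rw [redirect_of_ne h]
    exact hA y α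

theorem IsThreadTemplate.redirect_close {d₁ d₂ : ℝ} {d : ℕ} {p q : Fin n} {T : Template n}
    {lam : Fin (d + 1) → ℕ} {P : Fin (d + 1) → ℕ → Fin n} {A : TransStruct n}
    (hT : IsThreadTemplate d₁ d₂ d p q T lam P)
    {l : Fin (d + 1) → ℕ} (hl : ∀ i, 1 ≤ l i ∧ l i ≤ lam i) :
    ∀ i, ∃ j < lam i, redirect A (fun i => P i (lam i - 1)) (fun i => P i (lam i - l i))
      (P i (lam i - 1)) lb = P i j ∧ l i = lam i - j := fun i => by
  have := hl i
  exact ⟨lam i - l i, by omega,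
    redirect_apply (s := fun i => P i (lam i - 1)) hT.end_injective i, by omega⟩

/-- The map redirects the last transition of every thread so that the cycles get the lengths `l'`.
The new structure satisfies the same template, so its threads can be read off from it and the old
closing transitions restored from `l`. -/
theorem ncard_loopLengths_le {d₁ d₂ : ℝ} {d : ℕ} (hd : 1 ≤ d) (p : Fin n)
    {l l' : Fin (d + 1) → ℕ} (hl' : ∀ i, l' i ∈ loopRange n) :
    {ω : Fin n × TransStruct n | loopLengths d₁ d₂ d ω.2 p ω.1 = some l}.ncard ≤
      {ω : Fin n × TransStruct n | loopLengths d₁ d₂ d ω.2 p ω.1 = some l'}.ncard := by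
  have key : ∀ ω : Fin n × TransStruct n, loopLengths d₁ d₂ d ω.2 p ω.1 = some l →
      ∃ T lam P, IsThreadTemplate d₁ d₂ d p ω.1 T lam P ∧ Satisfies ω.2 T ∧
        ∀ i, ∃ j < lam i, ω.2 (P i (lam i - 1)) lb = P i j ∧ l i = lam i - j :=
    fun ω hω => ((loopLengths_eq_some_iff hd).1 hω).1
  have : Nonempty (Fin n) := ⟨p⟩
  have : Nonempty (Template n) := ⟨⟨fun _ _ => Set.univ, fun _ _ => Set.univ_nonempty⟩⟩
  choose! T lam P hT hA hc using key
  refine Set.ncard_le_ncard_of_injOn (fun ω => (ω.1, redirect ω.2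
    (fun i => P ω i (lam ω i - 1)) fun i => P ω i (lam ω i - l' i))) ?_ ?_ (Set.toFinite _)
  · intro ω hω
    refine (loopLengths_eq_some_iff hd).2 ⟨?_, hl'⟩
    have hb := fun i => (hT ω hω).le_of_mem_loopRange i (hl' i)
    exact ⟨T ω, lam ω, P ω, hT ω hω, (hT ω hω).satisfies_redirect (hA ω hω) hb,
      (hT ω hω).redirect_close hb⟩
  · rintro ⟨q, A⟩ hω ⟨q', A'⟩ hω' h
    obtain ⟨hq, h⟩ := Prod.mk.inj h
    obtain rfl : q = q' := hq
    have hb := fun i => (hT (q, A) hω).le_of_mem_loopRange i (hl' i)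
    have hb' := fun i => (hT (q, A') hω').le_of_mem_loopRange i (hl' i)
    -- The common image satisfies both templates with the tuple `l'`, so uniqueness identifies the
    -- threads of the two preimages.
    have hu := (hT (q, A) hω).unique hd ((hT (q, A) hω).satisfies_redirect (hA (q, A) hω) hb)
      ((hT (q, A) hω).redirect_close hb) (hT (q, A') hω')
      (h ▸ (hT (q, A') hω').satisfies_redirect (hA (q, A') hω') hb')
      (h ▸ (hT (q, A') hω').redirect_close hb')
    have hlam := fun i => congrFun hu.1 i
    have hP := hu.2.2
    have h2 := (hT (q, A) hω).two_le
    congr 1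
    funext y α
    by_cases hy : α = lb ∧ ∃ i, y = P (q, A) i (lam (q, A) i - 1)
    · obtain ⟨rfl, i, rfl⟩ := hy
      obtain ⟨j, hj, hj1, hj2⟩ := hc _ hω i
      obtain ⟨j', hj', hj1', hj2'⟩ := hc _ hω' i
      have := h2 i
      have := hlam i
      rw [← this, ← hP i _ (by omega), ← hP i _ (by omega)] at hj1'
      obtain rfl : j = j' := by omega
      exact hj1.trans hj1'.symm
    · have hy' : ¬ (α = lb ∧ ∃ i, y = P (q, A') i (lam (q, A') i - 1)) := by
        rintro ⟨rfl, i, rfl⟩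
        have := h2 i
        refine hy ⟨rfl, i, ?_⟩
        rw [hlam i, hP i _ (by have := hlam i; omega)]
      have := congrFun (congrFun h y) α
      rwa [redirect_of_ne hy, redirect_of_ne hy'] at this

/-! ### Uniform distributions -/

theorem uniformOn_apply_eq_ncard {Ω : Type*} [Finite Ω] [MeasurableSpace Ω]
    [MeasurableSingletonClass Ω] (s t : Set Ω) :
    uniformOn s t = ((s ∩ t).ncard : ENNReal) / (s.ncard : ENNReal) := by
  classical
  have := Fintype.ofFinite Ω
  have h := uniformOn_apply_finset (s := s.toFinset) (t := t.toFinset)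
  rw [Set.coe_toFinset, Set.coe_toFinset] at h
  rw [h, Set.ncard_eq_toFinset_card', Set.ncard_eq_toFinset_card', Set.toFinset_inter]

theorem uniformOn_univ_prod {Ω Ω' : Type*} [Finite Ω] [Finite Ω'] [MeasurableSpace Ω]
    [MeasurableSpace Ω'] [MeasurableSingletonClass Ω] [MeasurableSingletonClass Ω']
    [Nonempty Ω] [Nonempty Ω'] :
    (uniformOn (Set.univ : Set Ω)).prod (uniformOn (Set.univ : Set Ω')) =
      uniformOn (Set.univ : Set (Ω × Ω')) := by
  have h1 := isProbabilityMeasure_uniformOn (Set.finite_univ (α := Ω)) Set.univ_nonempty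
  have h2 := isProbabilityMeasure_uniformOn (Set.finite_univ (α := Ω')) Set.univ_nonempty
  refine Measure.ext_of_singleton fun ω => ?_
  rw [← Set.singleton_prod_singleton, Measure.prod_prod]
  simp only [uniformOn_apply_eq_ncard, Set.univ_inter, Set.ncard_singleton, Set.ncard_univ,
    Nat.card_prod, Set.singleton_prod_singleton]
  rw [Nat.cast_mul, ENNReal.div_eq_inv_mul, ENNReal.div_eq_inv_mul, ENNReal.div_eq_inv_mul,
    ENNReal.mul_inv (by simp) (by simp)]
  simp

theorem cond_uniformOn_univ {Ω : Type*} [Finite Ω] [MeasurableSpace Ω]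
    [MeasurableSingletonClass Ω] (s : Set Ω) :
    (uniformOn (Set.univ : Set Ω))[|s] = uniformOn s := by
  have h : Measure.count (Set.univ : Set Ω) ≠ ⊤ :=
    (Measure.count_apply_lt_top.2 Set.finite_univ).ne
  rw [uniformOn, uniformOn, cond_cond_eq_cond_inter' .univ s.toFinite.measurableSet h,
    Set.univ_inter]

/-- A random tuple whose values in a box have fibres of equal size has independent uniform
components. -/
theorem iIndepFun_and_map_of_ncard_eq {Ω ι : Type*} [Finite Ω] [MeasurableSpace Ω]
    [MeasurableSingletonClass Ω] [Fintype ι] [Nonempty ι] {E : Set Ω} (hE : E.Nonempty) {f : ι → Ω → ℕ}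
    {R : Set ℕ} (hR : R.Finite) (hf : ∀ ω ∈ E, ∀ i, f i ω ∈ R)
    (hc : ∀ g g' : ι → ℕ, (∀ i, g i ∈ R) → (∀ i, g' i ∈ R) →
      (E ∩ {ω | ∀ i, f i ω = g i}).ncard ≤ (E ∩ {ω | ∀ i, f i ω = g' i}).ncard) :
    iIndepFun f (uniformOn E) ∧ ∀ i, (uniformOn E).map (f i) = uniformOn R := by
  classical
  obtain ⟨ω₀, hω₀⟩ := hE
  have hprob := isProbabilityMeasure_uniformOn E.toFinite ⟨ω₀, hω₀⟩
  have hm : ∀ i, Measurable (f i) := fun i _ _ => (Set.toFinite _).measurableSet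
  have hm' : Measurable fun ω i => f i ω := fun _ _ => (Set.toFinite _).measurableSet
  -- All fibres over the box have the size of the fibre of `ω₀`.
  have hcard : E.ncard =
      (Fintype.piFinset fun _ : ι => hR.toFinset).card *
        (E ∩ {ω | ∀ i, f i ω = f i ω₀}).ncard := by
    have := Fintype.ofFinite Ω
    rw [Set.ncard_eq_toFinset_card' E, Finset.card_eq_sum_card_fiberwise
      (f := fun ω i => f i ω) (t := Fintype.piFinset fun _ : ι => hR.toFinset)]
    · rw [Finset.sum_const_nat]
      intro g hg
      have hg' : ∀ i, g i ∈ R := by simpa using hg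
      rw [← le_antisymm (hc g _ hg' (hf ω₀ hω₀)) (hc _ g (hf ω₀ hω₀) hg'),
        Set.ncard_eq_toFinset_card']
      congr 1
      ext ω
      simp [funext_iff]
    · intro ω hω
      simpa using hf ω (by simpa using hω)
  have hne : (E ∩ {ω | ∀ i, f i ω = f i ω₀}).Nonempty := ⟨ω₀, hω₀, fun _ => rfl⟩
  have hpos : (E ∩ {ω | ∀ i, f i ω = f i ω₀}).ncard ≠ 0 :=
    ((Set.ncard_pos (Set.toFinite _)).2 hne).ne'
  have hRne : R.Nonempty := ⟨_, hf ω₀ hω₀ (Classical.arbitrary ι)⟩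
  have hRp := isProbabilityMeasure_uniformOn hR hRne
  have hR0 : R.ncard ≠ 0 := ((Set.ncard_pos hR).2 hRne).ne'
  have hunif : ∀ m, uniformOn R {m} = if m ∈ R then (R.ncard : ENNReal)⁻¹ else 0 := fun m => by
    rw [uniformOn, cond_apply hR.measurableSet, Measure.count_apply_finite _ hR,
      ← Set.ncard_eq_toFinset_card _ hR]
    split_ifs with h
    · rw [Set.inter_eq_right.2 (Set.singleton_subset_iff.2 h), Measure.count_singleton, mul_one]
    · rw [Set.inter_singleton_eq_empty.2 h, measure_empty, mul_zero]
  -- Joint law equal to the product of the uniform laws; the marginals and the independence are read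
  -- off from it.
  have hlaw : (uniformOn E).map (fun ω i => f i ω) = Measure.pi fun _ : ι => uniformOn R := by
    refine Measure.ext_of_singleton fun g => ?_
    rw [Measure.map_apply hm' (measurableSet_singleton g), Measure.pi_singleton,
      uniformOn_apply_eq_ncard]
    have hset : E ∩ (fun ω i => f i ω) ⁻¹' {g} = E ∩ {ω | ∀ i, f i ω = g i} := by
      ext ω
      simp [funext_iff]
    simp only [hset, hunif]
    by_cases hg : ∀ i, g i ∈ R
    · rw [Finset.prod_congr rfl fun i _ => if_pos (hg i), Finset.prod_const, hcard,
        le_antisymm (hc g _ hg (hf ω₀ hω₀)) (hc _ g (hf ω₀ hω₀) hg), Fintype.card_piFinset,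
        Finset.prod_const,
        ← Set.ncard_eq_toFinset_card _ hR, Nat.cast_mul, ENNReal.div_eq_inv_mul,
        ENNReal.mul_inv (by simp [hR0]) (by simp), mul_assoc,
        ENNReal.inv_mul_cancel (by exact_mod_cast hpos) (by simp), mul_one, Nat.cast_pow,
        ENNReal.inv_pow, Finset.card_univ]
    · obtain ⟨i, hi⟩ := not_forall.1 hg
      rw [Finset.prod_eq_zero (Finset.mem_univ i) (if_neg hi)]
      have : E ∩ {ω | ∀ i, f i ω = g i} = ∅ := by
        rw [Set.eq_empty_iff_forall_notMem]
        rintro ω ⟨hω, h⟩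
        exact hi (h i ▸ hf ω hω i)
      simp [this]
  have hmap : ∀ i, (uniformOn E).map (f i) = uniformOn R := fun i => by
    have h := (measurePreserving_eval (fun _ : ι => uniformOn R) i).map_eq
    rw [← hlaw, Measure.map_map (measurable_pi_apply i) hm'] at h
    exact h
  refine ⟨?_, hmap⟩
  rw [iIndepFun_iff_map_fun_eq_pi_map fun i => (hm i).aemeasurable, hlaw]
  simp only [hmap]

/-! ### Moments of counts in product sets -/

section Product

variable {ι β : Type*} [Fintype ι] [DecidableEq ι] [DecidableEq β]

theorem filter_piFinset_eq_update {F : ι → Finset β} {x : ι} {H : Finset β} (h : H ⊆ F x) :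
    (Fintype.piFinset F).filter (fun f => f x ∈ H) =
      Fintype.piFinset (Function.update F x H) := by
  ext f
  simp only [Finset.mem_filter, Fintype.mem_piFinset]
  constructor
  · rintro ⟨h1, h2⟩ y
    by_cases hy : y = x
    · subst hy; simpa using h2
    · rw [Function.update_of_ne hy]; exact h1 y
  · intro h1
    have h2 : f x ∈ H := by simpa using h1 x
    refine ⟨fun y => ?_, h2⟩
    by_cases hy : y = x
    · subst hy; exact h h2
    · have := h1 y
      rwa [Function.update_of_ne hy] at this

theorem card_filter_piFinset {F : ι → Finset β} {x : ι} {H : Finset β} (h : H ⊆ F x)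
    (h0 : (F x).Nonempty) :
    (((Fintype.piFinset F).filter fun f => f x ∈ H).card : ℝ) =
      H.card / (F x).card * (Fintype.piFinset F).card := by
  have hne : ((F x).card : ℝ) ≠ 0 := by exact_mod_cast h0.card_pos.ne'
  rw [filter_piFinset_eq_update h, Fintype.card_piFinset, Fintype.card_piFinset,
    ← Finset.mul_prod_erase _ (fun i => (F i).card) (Finset.mem_univ x),
    ← Finset.mul_prod_erase _ (fun i => (Function.update F x H i).card) (Finset.mem_univ x),
    Function.update_self, Finset.prod_congr rfl fun y hy => by
      rw [Function.update_of_ne (Finset.ne_of_mem_erase hy)]]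
  push_cast
  field_simp

theorem card_filter_piFinset₂ {F : ι → Finset β} {x y : ι} (hxy : x ≠ y) {H : Finset β}
    (hx : H ⊆ F x) (hy : H ⊆ F y) (hx0 : (F x).Nonempty) (hy0 : (F y).Nonempty) :
    (((Fintype.piFinset F).filter fun f => f x ∈ H ∧ f y ∈ H).card : ℝ) =
      H.card / (F x).card * (H.card / (F y).card) * (Fintype.piFinset F).card := by
  have hu : Function.update F x H y = F y := Function.update_of_ne hxy.symm _ _
  rw [← Finset.filter_filter, filter_piFinset_eq_update hx,
    card_filter_piFinset (by rwa [hu]) (by rwa [hu]), hu, ← filter_piFinset_eq_update hx,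
    card_filter_piFinset hx hx0]
  ring

variable {F : ι → Finset β} {N : Finset ι} {V H : Finset β}

theorem sum_card_filter (hF : ∀ x ∈ N, F x = V) (hH : H ⊆ V)
    (hne : (Fintype.piFinset F).Nonempty) :
    ∑ f ∈ Fintype.piFinset F, ((N.filter fun x => f x ∈ H).card : ℝ) =
      N.card * (H.card / V.card) * (Fintype.piFinset F).card := by
  obtain ⟨f₀, hf₀⟩ := hne
  rw [Fintype.mem_piFinset] at hf₀
  simp only [Finset.card_filter, Nat.cast_sum]
  rw [Finset.sum_comm, Finset.sum_congr rfl fun x hx => ?_, Finset.sum_const, nsmul_eq_mul,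
    mul_assoc]
  rw [← Nat.cast_sum, ← Finset.card_filter, card_filter_piFinset (by rwa [hF x hx]) ⟨_, hf₀ x⟩,
    hF x hx]

/-- Second moment of a binomial variable: distinct coordinates in `N` are independent, each in `H`
with probability ρ = |H| / |V|. -/
theorem sum_card_filter_sq_le (hF : ∀ x ∈ N, F x = V) (hH : H ⊆ V)
    (hne : (Fintype.piFinset F).Nonempty) :
    ∑ f ∈ Fintype.piFinset F, ((N.filter fun x => f x ∈ H).card : ℝ) ^ 2 ≤
      (N.card * (H.card / V.card) + (N.card * (H.card / V.card)) ^ 2) *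
        (Fintype.piFinset F).card := by
  obtain ⟨f₀, hf₀⟩ := id hne
  rw [Fintype.mem_piFinset] at hf₀
  set c : ℝ := ((Fintype.piFinset F).card : ℝ)
  set ρ : ℝ := (H.card : ℝ) / V.card
  have hρ : 0 ≤ ρ := by positivity
  have hc : 0 ≤ c := by positivity
  have e : ∀ f : ι → β, ((N.filter fun x => f x ∈ H).card : ℝ) ^ 2 =
      ∑ x ∈ N, ∑ y ∈ N, if f x ∈ H ∧ f y ∈ H then (1 : ℝ) else 0 := fun f => by
    rw [Finset.card_filter, Nat.cast_sum, sq, Finset.sum_mul_sum]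
    refine Finset.sum_congr rfl fun x _ => Finset.sum_congr rfl fun y _ => ?_
    by_cases h1 : f x ∈ H <;> by_cases h2 : f y ∈ H <;> simp [h1, h2]
  simp only [e]
  rw [Finset.sum_comm]
  have hb : ∀ x ∈ N, ∑ f ∈ Fintype.piFinset F, ∑ y ∈ N,
      (if f x ∈ H ∧ f y ∈ H then (1 : ℝ) else 0) ≤ ρ * c + N.card * (ρ * ρ * c) := by
    intro x hx
    rw [Finset.sum_comm]
    -- On the diagonal the exact value is ρ; the extra ρ^2 is harmless and makes the bound uniform
    -- in y.
    have hb' : ∀ y ∈ N, ∑ f ∈ Fintype.piFinset F,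
        (if f x ∈ H ∧ f y ∈ H then (1 : ℝ) else 0) ≤ (if x = y then ρ * c else 0) + ρ * ρ * c := by
      intro y hy
      rw [← Finset.sum_filter, Finset.sum_const, nsmul_eq_mul, mul_one]
      by_cases hxy : x = y
      · subst hxy
        rw [if_pos rfl]
        simp only [and_self]
        rw [card_filter_piFinset (by rwa [hF x hx]) ⟨_, hf₀ x⟩, hF x hx]
        have : 0 ≤ ρ * ρ * c := by positivity
        linarith
      · rw [if_neg hxy, zero_add, card_filter_piFinset₂ hxy (by rwa [hF x hx]) (by rwa [hF y hy])
          ⟨_, hf₀ x⟩ ⟨_, hf₀ y⟩, hF x hx, hF y hy]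
    refine (Finset.sum_le_sum hb').trans ?_
    rw [Finset.sum_add_distrib, Finset.sum_ite_eq, if_pos hx, Finset.sum_const, nsmul_eq_mul]
  refine (Finset.sum_le_sum hb).trans ?_
  rw [Finset.sum_const, nsmul_eq_mul]
  apply le_of_eq
  ring

end Product

/-- The tower property in counting form: it suffices to compare expectations conditionally on π. -/
theorem sum_le_sum_of_fiber {Ω β : Type*} [Fintype Ω] [DecidableEq β] (π : Ω → β) {f g : Ω → ℝ}
    (h : ∀ ω₀, ∑ ω with π ω = π ω₀, f ω ≤ ∑ ω with π ω = π ω₀, g ω) : ∑ ω, f ω ≤ ∑ ω, g ω := by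
  have hm : ∀ ω ∈ (Finset.univ : Finset Ω), π ω ∈ Finset.univ.image π := fun ω _ =>
    Finset.mem_image_of_mem π (Finset.mem_univ ω)
  rw [← Finset.sum_fiberwise_of_maps_to hm f, ← Finset.sum_fiberwise_of_maps_to hm g]
  refine Finset.sum_le_sum fun b hb => ?_
  obtain ⟨ω₀, _, rfl⟩ := Finset.mem_image.1 hb
  exact h ω₀

/-! ### Sizes of the backward layers -/

/-- The states at backward distance less than `t` from `p`. -/
def inner (A : TransStruct n) (p : Fin n) : ℕ → Finset (Fin n)
  | 0 => ∅
  | t + 1 => ball A p t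

theorem inner_subset_ball (A : TransStruct n) (p : Fin n) (t : ℕ) :
    inner A p t ⊆ ball A p t := by
  cases t with
  | zero => simp [inner]
  | succ t => exact ball_mono A p t.le_succ

theorem mem_inner_iff {A : TransStruct n} {p x : Fin n} {t : ℕ} :
    x ∈ inner A p t ↔ ∃ s < t, x ∈ ball A p s := by
  cases t with
  | zero => simp [inner]
  | succ t =>
    exact ⟨fun h => ⟨t, t.lt_succ_self, h⟩, fun ⟨s, hs, h⟩ => ball_mono A p (Nat.lt_succ_iff.1 hs) h⟩

/-- The number of states at backward distance `t` from `p`. -/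
def layerCard (A : TransStruct n) (p : Fin n) (t : ℕ) : ℕ := (ball A p t \ inner A p t).card

theorem coe_ball_sdiff_inner (A : TransStruct n) (p : Fin n) (t : ℕ) :
    ((ball A p t \ inner A p t : Finset (Fin n)) : Set (Fin n)) = layer A p t := by
  ext x
  rw [mem_layer_iff, Finset.mem_coe, Finset.mem_sdiff, mem_inner_iff]
  push Not
  rfl

theorem ncard_layer (A : TransStruct n) (p : Fin n) (t : ℕ) :
    (layer A p t).ncard = layerCard A p t := by
  rw [← coe_ball_sdiff_inner, Set.ncard_coe_finset]
  rfl

theorem ncard_support (A : TransStruct n) (p : Fin n) (t : ℕ) :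
    (support A p t).ncard = (ball A p t).card := by
  rw [← coe_ball, Set.ncard_coe_finset]

theorem layerCard_zero (A : TransStruct n) (p : Fin n) : layerCard A p 0 = 1 := by
  simp [layerCard, inner, ball]

theorem card_inner_add_layerCard (A : TransStruct n) (p : Fin n) (t : ℕ) :
    (inner A p t).card + layerCard A p t = (ball A p t).card := by
  rw [layerCard, Finset.card_sdiff_of_subset (inner_subset_ball A p t)]
  have := Finset.card_le_card (inner_subset_ball A p t)
  omega

theorem card_ball_eq_sum (A : TransStruct n) (p : Fin n) (t : ℕ) :
    (ball A p t).card = ∑ s ∈ Finset.range (t + 1), layerCard A p s := by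
  induction t with
  | zero => simp [layerCard_zero, ball]
  | succ t ih => rw [Finset.sum_range_succ, ← ih, ← card_inner_add_layerCard]; rfl

/-- The allowed pairs of transitions of `x` in the structures that have the same backward balls
as `A` up to radius `t`. -/
def localChoices (A : TransStruct n) (p : Fin n) (t : ℕ) (x : Fin n) :
    Finset (Letter → Fin n) :=
  Finset.univ.filter fun g => ∀ s < t,
    (x ∈ ball A p (s + 1) ↔ x ∈ ball A p s ∨ ∃ α, g α ∈ ball A p s)

theorem mem_piFinset_localChoices {A A' : TransStruct n} {p : Fin n} {t : ℕ} :
    A' ∈ Fintype.piFinset (localChoices A p t) ↔ ∀ s ≤ t, ball A' p s = ball A p s := by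
  simp only [Fintype.mem_piFinset, localChoices, Finset.mem_filter, Finset.mem_univ, true_and]
  constructor
  · exact fun h => ball_eq_of_forall fun s hs x => h x s hs
  · intro h x s hs
    rw [← h (s + 1) hs, ← h s hs.le, mem_ball_succ]

/-- For a state outside the ball of radius t, knowing the balls up to t says only that both
transitions avoid the ball of radius t - 1. This makes the conditional law a product of uniform
laws. -/
theorem localChoices_eq {A : TransStruct n} {p x : Fin n} {t : ℕ} (hx : x ∉ ball A p t) :
    localChoices A p t x = Fintype.piFinset fun _ : Letter => (inner A p t)ᶜ := by
  ext g
  simp only [localChoices, Finset.mem_filter, Finset.mem_univ, true_and, Fintype.mem_piFinset,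
    Finset.mem_compl, mem_inner_iff]
  push Not
  constructor
  · intro h α s hs hg
    exact hx (ball_mono A p hs ((h s hs).2 (Or.inr ⟨α, hg⟩)))
  · intro h s hs
    have h1 : x ∉ ball A p (s + 1) := fun h => hx (ball_mono A p hs h)
    have h2 : x ∉ ball A p s := fun h => hx (ball_mono A p hs.le h)
    simp only [h1, h2, false_or, false_iff, not_exists]
    exact fun α => h α s hs

/-- The pairs of transitions that enter the ball of radius `t` but not the smaller ones. -/
def entering (A : TransStruct n) (p : Fin n) (t : ℕ) : Finset (Letter → Fin n) :=
  (Fintype.piFinset fun _ : Letter => (inner A p t)ᶜ) \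
    Fintype.piFinset fun _ : Letter => (ball A p t)ᶜ

theorem layerCard_succ_eq {A A' : TransStruct n} {p : Fin n} {t : ℕ}
    (h : ∀ s ≤ t, ball A' p s = ball A p s) :
    layerCard A' p (t + 1) = ((ball A p t)ᶜ.filter fun x => A' x ∈ entering A p t).card := by
  change (ball A' p (t + 1) \ ball A' p t).card = _
  congr 1
  ext x
  have hm := mem_piFinset_localChoices.2 h
  simp only [Finset.mem_sdiff, Finset.mem_filter, Finset.mem_compl, mem_ball_succ,
    h t le_rfl, entering]
  constructor
  · rintro ⟨h1 | ⟨α, h1⟩, h2⟩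
    · exact absurd h1 h2
    · refine ⟨h2, ?_, fun hn => ?_⟩
      · rw [← localChoices_eq h2]
        exact Fintype.mem_piFinset.1 hm x
      · exact Finset.mem_compl.1 (Fintype.mem_piFinset.1 hn α) h1
  · rintro ⟨h1, -, h2⟩
    refine ⟨Or.inr ?_, h1⟩
    by_contra hn
    push Not at hn
    exact h2 (Fintype.mem_piFinset.2 fun α => Finset.mem_compl.2 (hn α))

/-- Here a and m count the states outside the inner ball and outside the ball, ν all states, and s =
|ball|. The mean equals (a - m) (y + y^2) with y = m / a, and y is at least 1 - s / ν, so it falls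
short of 2 (a - m) by at most 4 s^2 / ν. -/
theorem mean_bounds {a m s ν : ℝ} (hm : 0 ≤ m) (hma : m ≤ a) (han : a ≤ ν)
    (hs : s = ν - m) :
    m * ((a ^ 2 - m ^ 2) / a ^ 2) ≤ 2 * (a - m) ∧
      2 * (a - m) - 4 / ν * s ^ 2 ≤ m * ((a ^ 2 - m ^ 2) / a ^ 2) := by
  -- For a = 0 the quotient takes the default value 0 and both bounds are trivial.
  rcases (hm.trans hma).eq_or_lt with ha | ha
  · subst ha
    obtain rfl : m = 0 := le_antisymm hma hm
    simp only [ne_eq, OfNat.ofNat_ne_zero, not_false_eq_true, zero_pow, sub_self, div_zero,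
      mul_zero, le_refl, zero_sub, neg_nonpos, true_and]
    positivity
  have hν : 0 < ν := ha.trans_le han
  constructor
  · rw [← mul_div_assoc, div_le_iff₀ (by positivity)]
    have h1 : m * (a + m) ≤ 2 * a ^ 2 := by nlinarith
    nlinarith [mul_le_mul_of_nonneg_left h1 (sub_nonneg.2 hma)]
  · have hmn : m / ν ≤ m / a := div_le_div_of_nonneg_left hm ha han
    have e1 : m * ((a ^ 2 - m ^ 2) / a ^ 2) = (a - m) * (m / a + (m / a) ^ 2) := by
      field_simp
      ring
    have hy : s / ν = 1 - m / ν := by rw [hs]; field_simp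
    have h0 : 0 ≤ m / ν := by positivity
    have h1 : m / a ≤ 1 := (div_le_one ha).2 hma
    have e2 : 4 / ν * s ^ 2 = 4 * s * (1 - m / ν) := by rw [← hy]; ring
    rw [e1, e2]
    have h3 : 2 - 4 * (1 - m / ν) ≤ m / a + (m / a) ^ 2 := by nlinarith [sq_nonneg (m / ν - 1)]
    have h4 : a - m ≤ s := by linarith
    have h5 : 0 ≤ 1 - m / ν := by linarith
    nlinarith [mul_le_mul_of_nonneg_left h3 (sub_nonneg.2 hma), mul_le_mul_of_nonneg_right h4 h5]

/-- Conditionally on the balls up to radius t, the size of the next layer is binomial with mean μ;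
this gives its first two moments. -/
theorem exists_mean (A : TransStruct n) (p : Fin n) (t : ℕ) :
    ∃ μ : ℝ, 0 ≤ μ ∧ μ ≤ 2 * layerCard A p t ∧
      2 * layerCard A p t - 4 / n * ((ball A p t).card : ℝ) ^ 2 ≤ μ ∧
      ∑ A' ∈ Fintype.piFinset (localChoices A p t), (layerCard A' p (t + 1) : ℝ) =
        μ * (Fintype.piFinset (localChoices A p t)).card ∧
      ∑ A' ∈ Fintype.piFinset (localChoices A p t), (layerCard A' p (t + 1) : ℝ) ^ 2 ≤
        (μ + μ ^ 2) * (Fintype.piFinset (localChoices A p t)).card := by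
  set V : Finset (Letter → Fin n) := Fintype.piFinset fun _ : Letter => (inner A p t)ᶜ with hV
  have hsub : (Fintype.piFinset fun _ : Letter => (ball A p t)ᶜ) ⊆ V :=
    Fintype.piFinset_subset _ _ fun _ => Finset.compl_subset_compl.2 (inner_subset_ball A p t)
  have hF : ∀ x ∈ (ball A p t)ᶜ, localChoices A p t x = V := fun x hx =>
    localChoices_eq (Finset.mem_compl.1 hx)
  have hH : entering A p t ⊆ V := Finset.sdiff_subset
  have hne : (Fintype.piFinset (localChoices A p t)).Nonempty :=
    ⟨A, mem_piFinset_localChoices.2 fun _ _ => rfl⟩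
  have hVc : (V.card : ℝ) = ((inner A p t)ᶜ.card : ℝ) ^ 2 := by
    rw [hV, Fintype.card_piFinset]
    simp
  have hHc : ((entering A p t).card : ℝ) =
      ((inner A p t)ᶜ.card : ℝ) ^ 2 - ((ball A p t)ᶜ.card : ℝ) ^ 2 := by
    rw [entering, Finset.card_sdiff_of_subset hsub, Nat.cast_sub (Finset.card_le_card hsub), hVc,
      Fintype.card_piFinset]
    simp
  have hle : (((ball A p t)ᶜ.card : ℕ) : ℝ) ≤ ((inner A p t)ᶜ.card : ℝ) := by
    exact_mod_cast Finset.card_le_card (Finset.compl_subset_compl.2 (inner_subset_ball A p t))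
  have hI : ((inner A p t)ᶜ.card : ℝ) = n - (inner A p t).card := by
    rw [Finset.card_compl, Nat.cast_sub (Finset.card_le_univ _), Fintype.card_fin]
  have hB : ((ball A p t)ᶜ.card : ℝ) = n - (ball A p t).card := by
    rw [Finset.card_compl, Nat.cast_sub (Finset.card_le_univ _), Fintype.card_fin]
  have hL : (layerCard A p t : ℝ) = ((inner A p t)ᶜ.card : ℝ) - ((ball A p t)ᶜ.card : ℝ) := by
    rw [hI, hB, ← card_inner_add_layerCard]
    push_cast
    ring
  have hb := mean_bounds (a := ((inner A p t)ᶜ.card : ℝ)) (m := ((ball A p t)ᶜ.card : ℝ))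
    (s := (ball A p t).card) (ν := n) (by positivity) hle
    (by rw [hI]; linarith [Nat.cast_nonneg (α := ℝ) (inner A p t).card]) (by rw [hB]; ring)
  refine ⟨(ball A p t)ᶜ.card * ((entering A p t).card / V.card), by positivity, ?_, ?_, ?_, ?_⟩
  · rw [hHc, hVc, hL]; exact hb.1
  · rw [hHc, hVc, hL]; exact hb.2
  · rw [← sum_card_filter hF hH hne]
    refine Finset.sum_congr rfl fun A' hA' => ?_
    rw [layerCard_succ_eq (mem_piFinset_localChoices.1 hA')]
  · refine le_trans (le_of_eq ?_) (sum_card_filter_sq_le hF hH hne)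
    refine Finset.sum_congr rfl fun A' hA' => ?_
    rw [layerCard_succ_eq (mem_piFinset_localChoices.1 hA')]

theorem fiber_eq_piFinset (A : TransStruct n) (p : Fin n) (t : ℕ) :
    (Finset.univ.filter fun A' : TransStruct n =>
      (fun s : Fin (t + 1) => ball A' p s) = fun s : Fin (t + 1) => ball A p s) =
      Fintype.piFinset (localChoices A p t) := by
  ext A'
  rw [mem_piFinset_localChoices]
  simp only [Finset.mem_filter, Finset.mem_univ, true_and, funext_iff]
  exact ⟨fun h s hs => h ⟨s, Nat.lt_succ_iff.2 hs⟩, fun h s => h s (Nat.lt_succ_iff.1 s.2)⟩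

theorem layerCard_congr {A A' : TransStruct n} {p : Fin n} {t : ℕ}
    (h : ∀ s ≤ t, ball A' p s = ball A p s) : layerCard A' p t = layerCard A p t := by
  cases t with
  | zero => simp [layerCard_zero]
  | succ t => rw [layerCard, layerCard, inner, inner, h _ le_rfl, h t t.le_succ]

theorem sum_layerCard_succ_le (p : Fin n) (t : ℕ) :
    ∑ A : TransStruct n, (layerCard A p (t + 1) : ℝ) ≤
      ∑ A : TransStruct n, 2 * (layerCard A p t : ℝ) := by
  refine sum_le_sum_of_fiber (fun A s => ball A p ((s : Fin (t + 1)) : ℕ)) fun A => ?_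
  rw [fiber_eq_piFinset]
  obtain ⟨μ, -, h1, -, h2, -⟩ := exists_mean A p t
  rw [h2, Finset.sum_congr rfl fun A' hA' => by
    rw [layerCard_congr (mem_piFinset_localChoices.1 hA')], Finset.sum_const, nsmul_eq_mul,
    mul_comm]
  gcongr

theorem le_sum_layerCard_succ (p : Fin n) (t : ℕ) :
    ∑ A : TransStruct n, (2 * (layerCard A p t : ℝ) - 4 / n * ((ball A p t).card : ℝ) ^ 2) ≤
      ∑ A : TransStruct n, (layerCard A p (t + 1) : ℝ) := by
  refine sum_le_sum_of_fiber (fun A s => ball A p ((s : Fin (t + 1)) : ℕ)) fun A => ?_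
  rw [fiber_eq_piFinset]
  obtain ⟨μ, -, -, h1, h2, -⟩ := exists_mean A p t
  rw [h2, Finset.sum_congr rfl fun A' hA' => by
    rw [layerCard_congr (mem_piFinset_localChoices.1 hA'),
      mem_piFinset_localChoices.1 hA' t le_rfl], Finset.sum_const, nsmul_eq_mul, mul_comm]
  gcongr

theorem sum_layerCard_succ_sq_le (p : Fin n) (t : ℕ) :
    ∑ A : TransStruct n, (layerCard A p (t + 1) : ℝ) ^ 2 ≤
      ∑ A : TransStruct n, (2 * (layerCard A p t : ℝ) + 4 * (layerCard A p t : ℝ) ^ 2) := by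
  refine sum_le_sum_of_fiber (fun A s => ball A p ((s : Fin (t + 1)) : ℕ)) fun A => ?_
  rw [fiber_eq_piFinset]
  obtain ⟨μ, h0, h1, -, -, h2⟩ := exists_mean A p t
  refine h2.trans ?_
  rw [Finset.sum_congr rfl fun A' hA' => by
    rw [layerCard_congr (mem_piFinset_localChoices.1 hA')], Finset.sum_const, nsmul_eq_mul,
    mul_comm]
  gcongr
  nlinarith

theorem sum_layerCard_le (p : Fin n) (t : ℕ) :
    ∑ A : TransStruct n, (layerCard A p t : ℝ) ≤ 2 ^ t * Fintype.card (TransStruct n) := by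
  induction t with
  | zero => simp [layerCard_zero]
  | succ t ih =>
    refine (sum_layerCard_succ_le p t).trans ?_
    rw [← Finset.mul_sum, pow_succ]
    linarith

/-- The bound solves the recursion s(t+1) = 2 · 2^t + 4 s(t), s(0) = 1, that comes from μ + μ^2 with
μ ≤ 2 |L_t|. -/
theorem sum_layerCard_sq_le (p : Fin n) (t : ℕ) :
    ∑ A : TransStruct n, (layerCard A p t : ℝ) ^ 2 ≤
      (2 * 4 ^ t - 2 ^ t) * Fintype.card (TransStruct n) := by
  induction t with
  | zero => norm_num [layerCard_zero]
  | succ t ih =>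
    refine (sum_layerCard_succ_sq_le p t).trans ?_
    rw [Finset.sum_add_distrib, ← Finset.mul_sum, ← Finset.mul_sum, pow_succ, pow_succ]
    have := sum_layerCard_le p t
    linarith

theorem sum_card_ball_le (p : Fin n) (t : ℕ) :
    ∑ A : TransStruct n, ((ball A p t).card : ℝ) ≤ 2 * 2 ^ t * Fintype.card (TransStruct n) := by
  simp only [card_ball_eq_sum, Nat.cast_sum]
  rw [Finset.sum_comm]
  refine (Finset.sum_le_sum fun s _ => sum_layerCard_le p s).trans ?_
  rw [← Finset.sum_mul, geom_sum_eq (by norm_num)]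
  gcongr
  rw [pow_succ]
  norm_num
  linarith

/-- Cauchy-Schwarz with the weights 2^s, the growth rate of the layers, avoids a factor t in the
bound. -/
theorem sum_card_ball_sq_le (p : Fin n) (t : ℕ) :
    ∑ A : TransStruct n, ((ball A p t).card : ℝ) ^ 2 ≤
      8 * 4 ^ t * Fintype.card (TransStruct n) := by
  have hg : ∑ s ∈ Finset.range (t + 1), (2 : ℝ) ^ s ≤ 2 * 2 ^ t := by
    rw [geom_sum_eq (by norm_num), pow_succ]
    norm_num
    linarith
  have h1 : ∀ A : TransStruct n, ((ball A p t).card : ℝ) ^ 2 ≤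
      2 * 2 ^ t * ∑ s ∈ Finset.range (t + 1), (layerCard A p s : ℝ) ^ 2 / (2 : ℝ) ^ s := by
    intro A
    have := Finset.sq_sum_div_le_sum_sq_div (Finset.range (t + 1))
      (fun s => (layerCard A p s : ℝ)) (g := fun s => (2 : ℝ) ^ s) (fun s _ => by positivity)
    rw [card_ball_eq_sum, Nat.cast_sum]
    rw [div_le_iff₀ (Finset.sum_pos (fun s _ => by positivity) (by simp))] at this
    refine this.trans ?_
    rw [mul_comm]
    gcongr
  refine (Finset.sum_le_sum fun A _ => h1 A).trans ?_
  rw [← Finset.mul_sum, Finset.sum_comm]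
  have h2 : ∀ s ∈ Finset.range (t + 1), ∑ A : TransStruct n, (layerCard A p s : ℝ) ^ 2 / (2 : ℝ) ^ s ≤
      2 * 2 ^ s * (Fintype.card (TransStruct n) : ℝ) := by
    intro s _
    rw [← Finset.sum_div, div_le_iff₀ (by positivity)]
    refine (sum_layerCard_sq_le p s).trans ?_
    have e : (4 : ℝ) ^ s = 2 ^ s * 2 ^ s := by rw [← mul_pow]; norm_num
    rw [e]
    have : (0 : ℝ) ≤ 2 ^ s * Fintype.card (TransStruct n) := by positivity
    linarith
  have e : (4 : ℝ) ^ t = 2 ^ t * 2 ^ t := by rw [← mul_pow]; norm_num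
  calc _ ≤ 2 * 2 ^ t * ∑ s ∈ Finset.range (t + 1), 2 * 2 ^ s * (Fintype.card (TransStruct n) : ℝ) := by
        gcongr with s hs; exact h2 s hs
    _ = 2 * 2 ^ t * (2 * (∑ s ∈ Finset.range (t + 1), (2 : ℝ) ^ s) *
        Fintype.card (TransStruct n)) := by
        rw [← Finset.sum_mul, ← Finset.mul_sum]
    _ ≤ 2 * 2 ^ t * (2 * (2 * 2 ^ t) * Fintype.card (TransStruct n)) := by gcongr
    _ = _ := by rw [e]; ring

/-- The loss at step t is at most (4 / n) · 8 · 4^t. Doubled at each later step, the losses stay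
below 16 · 4^t / n. -/
theorem le_sum_layerCard (p : Fin n) (t : ℕ) :
    (2 ^ t - 16 * 4 ^ t / n) * Fintype.card (TransStruct n) ≤
      ∑ A : TransStruct n, (layerCard A p t : ℝ) := by
  induction t with
  | zero =>
    simp only [layerCard_zero, pow_zero, Nat.cast_one, Finset.sum_const, Finset.card_univ,
      nsmul_eq_mul, mul_one]
    have : (0 : ℝ) ≤ 16 / n * Fintype.card (TransStruct n) := by positivity
    linarith
  | succ t ih =>
    refine le_trans ?_ (le_sum_layerCard_succ p t)
    rw [Finset.sum_sub_distrib, ← Finset.mul_sum, ← Finset.mul_sum]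
    have h1 : 4 / (n : ℝ) * ∑ A : TransStruct n, ((ball A p t).card : ℝ) ^ 2 ≤
        4 / (n : ℝ) * (8 * 4 ^ t * Fintype.card (TransStruct n)) := by
      gcongr; exact sum_card_ball_sq_le p t
    have e : (2 ^ (t + 1) - 16 * 4 ^ (t + 1) / (n : ℝ)) * Fintype.card (TransStruct n) =
        2 * ((2 ^ t - 16 * 4 ^ t / n) * Fintype.card (TransStruct n)) -
          4 / (n : ℝ) * (8 * 4 ^ t * Fintype.card (TransStruct n)) := by
      rw [pow_succ, pow_succ]; ring
    rw [e]
    linarith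

/-! ### The backward substructure has the required sizes with positive probability -/

theorem sqrt_le_two_pow_depth (hn : 0 < n) : Real.sqrt n ≤ 2 ^ depth n := by
  have h0 : 0 < Real.sqrt n := Real.sqrt_pos.2 (by exact_mod_cast hn)
  rw [← Real.rpow_natCast, ← Real.logb_le_iff_le_rpow (by norm_num) h0]
  exact Nat.le_ceil _

theorem two_pow_depth_le (hn : 0 < n) : (2 : ℝ) ^ depth n ≤ 2 * Real.sqrt n := by
  have h1 : 1 ≤ Real.sqrt n := Real.one_le_sqrt.2 (by exact_mod_cast hn)
  have h0 : 0 < Real.sqrt n := by linarith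
  have hlog : 0 ≤ Real.logb 2 (Real.sqrt n) := Real.logb_nonneg (by norm_num) h1
  have h2 : (depth n : ℝ) ≤ Real.logb 2 (Real.sqrt n) + 1 := (Nat.ceil_lt_add_one hlog).le
  calc (2 : ℝ) ^ depth n = 2 ^ (depth n : ℝ) := (Real.rpow_natCast _ _).symm
    _ ≤ 2 ^ (Real.logb 2 (Real.sqrt n) + 1) :=
        Real.rpow_le_rpow_of_exponent_le (by norm_num) h2
    _ = 2 * Real.sqrt n := by
        rw [Real.rpow_add (by norm_num), Real.rpow_logb (by norm_num) (by norm_num) h0,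
          Real.rpow_one, mul_comm]

open Classical in
/-- The structures whose backward substructure from `p` has the required sizes. -/
noncomputable def goodBack (d₁ d₂ : ℝ) (p : Fin n) : Finset (TransStruct n) :=
  Finset.univ.filter fun A => ((ball A p (depth n)).card : ℝ) ≤ d₁ * Real.sqrt n ∧
    d₂ * Real.sqrt n ≤ layerCard A p (depth n)

/-- Paley-Zygmund shows that the last layer is large with probability at least 1/32; Markov shows
that the ball is too large with probability at most 1/64. -/
theorem card_transStruct_le_card_goodBack (hn : 2 ^ 14 ≤ n) (p : Fin n) :
    (Fintype.card (TransStruct n) : ℝ) / 64 ≤ (goodBack 256 (1 / 4) p).card := by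
  classical
  set M : ℝ := (Fintype.card (TransStruct n) : ℝ) with hM
  set h := depth n
  have hn0 : 0 < n := p.pos
  have hnR : (0 : ℝ) < n := by exact_mod_cast hn0
  have hs0 : 0 < Real.sqrt n := Real.sqrt_pos.2 hnR
  have hlow := sqrt_le_two_pow_depth hn0
  have hup := two_pow_depth_le hn0
  have hM0 : 0 < M := by
    rw [hM]; exact_mod_cast Fintype.card_pos_iff.2 ⟨fun _ _ => p⟩
  have hp0 : (0 : ℝ) < 2 ^ h := by positivity
  have h4 : (4 : ℝ) ^ h = 2 ^ h * 2 ^ h := by rw [← mul_pow]; norm_num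
  have hsq : Real.sqrt n * Real.sqrt n = n := Real.mul_self_sqrt hnR.le
  have hbig : (128 : ℝ) ≤ 2 ^ h := by
    refine le_trans ?_ hlow
    rw [Real.le_sqrt (by norm_num) hnR.le]
    norm_num
    exact_mod_cast hn
  -- As 4^h ≤ 4 n, the total loss is at most 64, which is at most half of 2^h ≥ 128.
  have hmean : 2 ^ h / 2 * M ≤ ∑ A : TransStruct n, (layerCard A p h : ℝ) := by
    refine le_trans ?_ (le_sum_layerCard p h)
    have : 16 * (4 : ℝ) ^ h / n ≤ 64 := by
      rw [div_le_iff₀ hnR, h4]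
      nlinarith
    gcongr
    linarith
  set B := Finset.univ.filter fun A : TransStruct n => (1 / 4 : ℝ) * 2 ^ h ≤ layerCard A p h
    with hB
  set D := Finset.univ.filter fun A : TransStruct n =>
    (256 : ℝ) * Real.sqrt n < (ball A p h).card with hD
  have hBsum : 2 ^ h / 4 * M ≤ ∑ A ∈ B, (layerCard A p h : ℝ) := by
    have h1 := Finset.sum_filter_add_sum_filter_not (Finset.univ : Finset (TransStruct n))
      (fun A => (1 / 4 : ℝ) * 2 ^ h ≤ layerCard A p h) (fun A => (layerCard A p h : ℝ))
    have h2 : ∑ A ∈ Finset.univ.filter (fun A : TransStruct n =>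
        ¬ (1 / 4 : ℝ) * 2 ^ h ≤ layerCard A p h), (layerCard A p h : ℝ) ≤ 2 ^ h / 4 * M := by
      refine (Finset.sum_le_card_nsmul _ _ (1 / 4 * 2 ^ h) fun A hA =>
        (not_le.1 (Finset.mem_filter.1 hA).2).le).trans ?_
      rw [nsmul_eq_mul, mul_comm]
      have : ((Finset.univ.filter (fun A : TransStruct n =>
        ¬ (1 / 4 : ℝ) * 2 ^ h ≤ layerCard A p h)).card : ℝ) ≤ M := by
        rw [hM]; exact_mod_cast Finset.card_le_univ _
      nlinarith
    rw [← hB] at h1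
    linarith
  have hBcard : M / 32 ≤ B.card := by
    have h1 : (∑ A ∈ B, (layerCard A p h : ℝ)) ^ 2 ≤
        B.card * ∑ A ∈ B, (layerCard A p h : ℝ) ^ 2 := sq_sum_le_card_mul_sum_sq
    have h2 : ∑ A ∈ B, (layerCard A p h : ℝ) ^ 2 ≤ 2 * 4 ^ h * M := by
      refine (Finset.sum_le_sum_of_subset_of_nonneg (Finset.subset_univ B)
        fun _ _ _ => by positivity).trans ((sum_layerCard_sq_le p h).trans ?_)
      gcongr
      linarith
    have h3 : (2 ^ h / 4 * M) ^ 2 ≤ B.card * (2 * 4 ^ h * M) :=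
      (pow_le_pow_left₀ (by positivity) hBsum 2).trans (h1.trans (by gcongr))
    rw [h4] at h3
    have h5 : 0 < (2 ^ h * 2 ^ h) * M := by positivity
    by_contra hlt
    nlinarith [mul_lt_mul_of_pos_right (not_le.1 hlt) h5]
  -- The mean size of the ball is at most 2 · 2^h ≤ 4 √n, so d₁ = 256 gives 4/256 = 1/64.
  have hDcard : (D.card : ℝ) ≤ M / 64 := by
    have h1 : D.card * (256 * Real.sqrt n) ≤ ∑ A ∈ D, ((ball A p h).card : ℝ) := by
      rw [← nsmul_eq_mul]
      exact Finset.card_nsmul_le_sum _ _ _ fun A hA => (Finset.mem_filter.1 hA).2.le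
    have h2 : ∑ A ∈ D, ((ball A p h).card : ℝ) ≤ 2 * 2 ^ h * M :=
      (Finset.sum_le_sum_of_subset_of_nonneg (Finset.subset_univ D)
        fun _ _ _ => by positivity).trans (sum_card_ball_le p h)
    by_contra hlt
    nlinarith [mul_lt_mul_of_pos_right (not_le.1 hlt) hs0, mul_le_mul_of_nonneg_right hup hM0.le]
  have hsub : B ⊆ goodBack 256 (1 / 4) p ∪ D := by
    intro A hA
    rw [Finset.mem_union, goodBack, Finset.mem_filter, hD, Finset.mem_filter]
    by_cases hc : (256 : ℝ) * Real.sqrt n < (ball A p h).card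
    · exact Or.inr ⟨Finset.mem_univ _, hc⟩
    · refine Or.inl ⟨Finset.mem_univ _, not_lt.1 hc, ?_⟩
      have := (Finset.mem_filter.1 hA).2
      refine le_trans ?_ this
      gcongr
  have hcard : (B.card : ℝ) ≤ (goodBack 256 (1 / 4) p).card + D.card := by
    exact_mod_cast (Finset.card_le_card hsub).trans (Finset.card_union_le _ _)
  linarith

/-! ### Structures that satisfy a thread template built on themselves -/

/-- A core, a path and threads of `A` as in the definition of the thread templates. -/
structure IsThreadData (d₁ d₂ : ℝ) (d : ℕ) (A : TransStruct n) (p q : Fin n) (i₀ : ℕ)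
    (w : List Letter) (lam l : Fin (d + 1) → ℕ) (x : ℕ → Fin n) (P : Fin (d + 1) → ℕ → Fin n) :
    Prop extends IsThreadPath d A p q w lam l x P where
  core : IsCore d₁ d₂ A p i₀ w
  path_notMem : ∀ k ≤ (pathWord d w).length, x k ∉ cycleSupport A p i₀
  path_inj : ∀ k ≤ (pathWord d w).length, ∀ l ≤ (pathWord d w).length, x k = x l → k = l
  lam_range : ∀ i, 2 * Real.sqrt n ≤ lam i ∧ (lam i : ℝ) ≤ 3 * Real.sqrt n
  new : ∀ i j, 1 ≤ j → j < lam i →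
    P i j ∉ cycleSupport A p i₀ ∧ ∀ k ≤ (pathWord d w).length, P i j ≠ x k
  thread_inj : ∀ i j i' j', j < lam i → j' < lam i' → P i j = P i' j' → i = i' ∧ j = j'

theorem IsThreadData.unique {d₁ d₂ : ℝ} {d : ℕ} (hd : 1 ≤ d) {A : TransStruct n} {p q : Fin n}
    {i i' : ℕ} {w w' : List Letter} {lam l lam' l' : Fin (d + 1) → ℕ} {x x' : ℕ → Fin n}
    {P P' : Fin (d + 1) → ℕ → Fin n} (h : IsThreadData d₁ d₂ d A p q i w lam l x P)
    (h' : IsThreadData d₁ d₂ d A p q i' w' lam' l' x' P') :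
    i = i' ∧ w = w' ∧ lam = lam' ∧ l = l' ∧ (∀ k ≤ (pathWord d w).length, x k = x' k) ∧
      ∀ i, ∀ j < lam i, P i j = P' i j := by
  obtain ⟨rfl, rfl⟩ := h.core.unique h'.core
  have hu := h.toIsThreadPath.unique hd h'.toIsThreadPath
  exact ⟨rfl, rfl, hu.1, hu.2.1, h.toIsThreadPath.path_eq h'.toIsThreadPath, hu.2.2⟩

open Classical in
/-- The allowed targets in the cycle template built on `A`. -/
def cycleAllowed (A : TransStruct n) (p : Fin n) (i : ℕ) (y : Fin n) (α : Letter) :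
    Set (Fin n) :=
  if FwdExplored A p i y α then {A y α} else backAllowed A p (depth n) y α

theorem mem_cycleAllowed_self (A : TransStruct n) (p : Fin n) (i : ℕ) (y : Fin n) (α : Letter) :
    A y α ∈ cycleAllowed A p i y α := by
  unfold cycleAllowed
  split_ifs
  · rfl
  · exact mem_backAllowed_self A p _ y α

theorem isCycleTemplate_self {d₁ d₂ : ℝ} {A : TransStruct n} {p : Fin n} {i : ℕ}
    {w : List Letter} (h : IsCore d₁ d₂ A p i w) :
    IsCycleTemplate d₁ d₂ p A i
      ⟨cycleAllowed A p i, fun y α => ⟨_, mem_cycleAllowed_self A p i y α⟩⟩ := by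
  refine ⟨h.success, ⟨backAllowed A p (depth n), fun y α => ⟨_, mem_backAllowed_self A p _ y α⟩⟩,
    ⟨A, h.card_support, h.card_layer, fun _ _ => rfl⟩, fun y α => mem_backAllowed_self A p _ y α,
    fun y α => ⟨fun hx => if_pos hx, fun hx => if_neg hx⟩⟩

open Classical in
/-- The allowed targets in the thread template built on `A`. -/
def threadAllowed {d : ℕ} (A : TransStruct n) (p : Fin n) (i₀ : ℕ) (w : List Letter)
    (lam : Fin (d + 1) → ℕ) (x : ℕ → Fin n) (P : Fin (d + 1) → ℕ → Fin n) (y : Fin n)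
    (α : Letter) : Set (Fin n) :=
  if (∃ k, y = x k ∧ (pathWord d w)[k]? = some α) ∨
    ∃ i j, j + 1 < lam i ∧ y = P i j ∧ α = lb then {A y α}
  else if ∃ i, y = P i (lam i - 1) ∧ α = lb then
    {z | ∃ i, y = P i (lam i - 1) ∧ ∃ j < lam i, z = P i j}
  else cycleAllowed A p i₀ y α

/-- `A` itself serves as the structure from which the backward, cycle and thread templates are
built. -/
theorem IsThreadData.isLoopTuple {d₁ d₂ : ℝ} {d : ℕ} {A : TransStruct n} {p q : Fin n} {i₀ : ℕ}
    {w : List Letter} {lam l : Fin (d + 1) → ℕ} {x : ℕ → Fin n} {P : Fin (d + 1) → ℕ → Fin n}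
    (h : IsThreadData d₁ d₂ d A p q i₀ w lam l x P) : IsLoopTuple d₁ d₂ d A p q l := by
  have hlam2 : ∀ i, 2 ≤ lam i := fun i => two_le_of_two_mul_sqrt_le p (h.lam_range i).1
  have hend : ∀ i, ¬ ((∃ k, P i (lam i - 1) = x k ∧ (pathWord d w)[k]? = some lb) ∨
      ∃ i' j, j + 1 < lam i' ∧ P i (lam i - 1) = P i' j ∧ lb = lb) := by
    rintro i (⟨k, hk, hw⟩ | ⟨i', j, hj, hP, -⟩)
    · have := hlam2 i
      exact (h.new i (lam i - 1) (by omega) (by omega)).2 k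
        (List.getElem?_eq_some_iff.1 hw).1.le hk
    · have := hlam2 i
      obtain ⟨rfl, h2⟩ := h.thread_inj i _ i' j (by omega) (by omega) hP
      omega
  have hclose : ∀ i, ∃ j < lam i, A (P i (lam i - 1)) lb = P i j ∧ l i = lam i - j := fun i => by
    have h1 := (h.rho i).pos
    have h2 := (h.rho i).le
    exact ⟨lam i - l i, by omega, (h.rho i).close, by omega⟩
  have hmem : ∀ y α, A y α ∈ threadAllowed A p i₀ w lam x P y α := by
    intro y α
    unfold threadAllowed
    split_ifs with h1 h2
    · rfl
    · obtain ⟨i, rfl, rfl⟩ := h2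
      obtain ⟨j, hj, hc, -⟩ := hclose i
      exact ⟨i, rfl, j, hj, hc⟩
    · exact mem_cycleAllowed_self A p i₀ y α
  refine ⟨⟨threadAllowed A p i₀ w lam x P, fun y α => ⟨_, hmem y α⟩⟩, lam, P, ?_, hmem, hclose⟩
  refine ⟨_, A, i₀, w, x, isCycleTemplate_self h.core, h.core.word, h.start, h.path_notMem,
    h.path_inj, h.root, h.branch, h.lam_range, h.new, h.thread_inj, ?_, ?_, ?_, ?_⟩
  · intro k α hk
    rw [← h.step k α hk]
    exact if_pos (Or.inl ⟨k, rfl, hk⟩)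
  · intro i j hj
    rw [← (h.rho i).step j hj]
    exact if_pos (Or.inr ⟨i, j, hj, rfl, rfl⟩)
  · intro i
    change threadAllowed A p i₀ w lam x P _ _ = _
    rw [threadAllowed, if_neg (hend i), if_pos ⟨i, rfl, rfl⟩]
    ext z
    constructor
    · rintro ⟨i', hi', j, hj, rfl⟩
      have := hlam2 i
      have := hlam2 i'
      obtain ⟨rfl, -⟩ := h.thread_inj i _ i' _ (by omega) (by omega) hi'
      exact ⟨j, hj, rfl⟩
    · rintro ⟨j, hj, rfl⟩
      exact ⟨i, rfl, j, hj, rfl⟩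
  · intro y α h1 h2
    change threadAllowed A p i₀ w lam x P _ _ = _
    rw [threadAllowed, if_neg, if_neg]
    · rintro ⟨i, rfl, rfl⟩
      exact h2 ⟨i, _, by have := hlam2 i; omega, rfl, rfl⟩
    · rintro (h3 | ⟨i, j, hj, rfl, rfl⟩)
      · exact h1 h3
      · exact h2 ⟨i, j, by omega, rfl, rfl⟩

/-! ### Overwriting transitions -/

theorem cons_pathWord {d : ℕ} (hd : 1 ≤ d) (w : List Letter) :
    la :: pathWord d w = (List.replicate d (la :: w)).flatten := by
  obtain ⟨d, rfl⟩ := Nat.exists_eq_add_of_le' hd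
  simp [pathWord, List.replicate_succ]

theorem getElem?_flatten_replicate {c d : ℕ} (hc : c < d) (w : List Letter) :
    (List.replicate d (la :: w)).flatten[c * (w.length + 1)]? = some la := by
  induction c generalizing d with
  | zero =>
    obtain ⟨d, rfl⟩ := Nat.exists_eq_add_of_le' (Nat.one_le_of_lt hc)
    simp [List.replicate_succ]
  | succ c ih =>
    obtain ⟨d, rfl⟩ := Nat.exists_eq_add_of_le' (Nat.one_le_of_lt hc)
    rw [List.replicate_succ, List.flatten_cons, List.getElem?_append_right (by simp [Nat.succ_mul]),
      ← ih (d := d) (by omega)]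
    congr 1
    simp only [List.length_cons]
    rw [Nat.succ_mul]
    omega

/-- Since a · w (a w)^(d-1) = (a w)^d, an a follows every prefix w (a w)^(c-1) except the whole
word. So the path leaves a branching state by a, while the thread leaves it by b. -/
theorem getElem?_pathWord {c d : ℕ} (hc : 1 ≤ c) (w : List Letter)
    (h : c * (w.length + 1) - 1 < (pathWord d w).length) (hd : 1 ≤ d) :
    (pathWord d w)[c * (w.length + 1) - 1]? = some la := by
  have h1 := length_pathWord hd w
  have hcd : c < d := by
    by_contra hge
    have := Nat.mul_le_mul_right (w.length + 1) (not_lt.1 hge)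
    omega
  have h2 := getElem?_flatten_replicate hcd w
  rw [← cons_pathWord hd] at h2
  have h3 : c * (w.length + 1) = (c * (w.length + 1) - 1) + 1 := by
    have : 1 * 1 ≤ c * (w.length + 1) := Nat.mul_le_mul hc (by omega)
    omega
  rw [h3, List.getElem?_cons_succ] at h2
  exact h2

/-- The states of a forward process, a path and threads that avoid the backward support of `A`
and each other. -/
structure IsFresh {d : ℕ} (A : TransStruct n) (p : Fin n) (i : ℕ) (w : List Letter)
    (lam : Fin (d + 1) → ℕ) (r x : ℕ → Fin n) (P : Fin (d + 1) → ℕ → Fin n) : Prop where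
  r_notMem : ∀ j < i, r j ∉ support A p (depth n)
  r_inj : ∀ j < i, ∀ k < i, r j = r k → j = k
  r_last : r i ∈ layer A p (depth n)
  word : ∃ v, w = wordAt i ++ v ∧ IsMinWord A p (r i) v
  x_notMem : ∀ k ≤ (pathWord d w).length, x k ∉ support A p (depth n)
  x_ne_r : ∀ k ≤ (pathWord d w).length, ∀ j < i, x k ≠ r j
  x_inj : ∀ k ≤ (pathWord d w).length, ∀ l ≤ (pathWord d w).length, x k = x l → k = l
  root : P 0 0 = p
  branch : ∀ c : Fin (d + 1), c ≠ 0 → P c 0 = x ((c : ℕ) * (w.length + 1) - 1)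
  P_notMem : ∀ c j, 1 ≤ j → j < lam c → P c j ∉ support A p (depth n)
  P_ne_r : ∀ c j, 1 ≤ j → j < lam c → ∀ k < i, P c j ≠ r k
  P_ne_x : ∀ c j, 1 ≤ j → j < lam c → ∀ k ≤ (pathWord d w).length, P c j ≠ x k
  P_inj : ∀ c j c' j', 1 ≤ j → 1 ≤ j' → j < lam c → j' < lam c' → P c j = P c' j' →
    c = c' ∧ j = j'

section Fresh

variable {d : ℕ} {A A' : TransStruct n} {p : Fin n} {i : ℕ} {w : List Letter}
  {lam l : Fin (d + 1) → ℕ} {r x : ℕ → Fin n} {P : Fin (d + 1) → ℕ → Fin n}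

theorem IsFresh.thread_zero (h : IsFresh A p i w lam r x P) (hd : 1 ≤ d) (c : Fin (d + 1)) :
    (c = 0 ∧ P c 0 = p) ∨
      (c ≠ 0 ∧ ∃ k ≤ (pathWord d w).length, k + 1 = (c : ℕ) * (w.length + 1) ∧ P c 0 = x k) := by
  by_cases hc : c = 0
  · subst hc
    exact Or.inl ⟨rfl, h.root⟩
  · refine Or.inr ⟨hc, _, index_le_length_pathWord hd w c, ?_, h.branch c hc⟩
    have h1 : 1 ≤ (c : ℕ) := Nat.one_le_iff_ne_zero.2 fun h => hc (Fin.ext h)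
    have : 1 * 1 ≤ (c : ℕ) * (w.length + 1) := Nat.mul_le_mul h1 (by omega)
    omega

theorem IsFresh.thread_inj (h : IsFresh A p i w lam r x P) (hd : 1 ≤ d) :
    ∀ c j c' j', j < lam c → j' < lam c' → P c j = P c' j' → c = c' ∧ j = j' := by
  have key : ∀ c c' j', 1 ≤ j' → j' < lam c' → P c 0 ≠ P c' j' := by
    intro c c' j' h1 h2 he
    rcases h.thread_zero hd c with ⟨-, h3⟩ | ⟨-, k, hk, -, h3⟩
    · exact h.P_notMem c' j' h1 h2 (he ▸ h3.symm ▸ self_mem_support A p _)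
    · exact h.P_ne_x c' j' h1 h2 k hk (he.symm.trans h3)
  intro c j c' j' hj hj' he
  rcases Nat.eq_zero_or_pos j with rfl | hj0 <;> rcases Nat.eq_zero_or_pos j' with rfl | hj0'
  · refine ⟨?_, rfl⟩
    rcases h.thread_zero hd c with ⟨h1, h2⟩ | ⟨-, k, hk, hk1, h2⟩ <;>
      rcases h.thread_zero hd c' with ⟨h1', h2'⟩ | ⟨-, k', hk', hk1', h2'⟩
    · rw [h1, h1']
    · refine (h.x_notMem k' hk' ?_).elim
      rw [← h2.symm.trans (he.trans h2')]
      exact self_mem_support A p _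
    · refine (h.x_notMem k hk ?_).elim
      rw [← h2'.symm.trans (he.symm.trans h2)]
      exact self_mem_support A p _
    · have := h.x_inj k hk k' hk' (h2.symm.trans (he.trans h2'))
      rw [← this, hk1] at hk1'
      exact Fin.ext (Nat.eq_of_mul_eq_mul_right (Nat.succ_pos _) hk1')
  · exact absurd he (key c c' j' hj0' hj')
  · exact absurd he.symm (key c' c j hj0 hj)
  · exact h.P_inj c j c' j' hj0 hj0' hj hj' he

/-- Only transitions into the balls of radius less than h from states other than `p` matter, and the
changes neither create nor destroy any. -/
theorem IsFresh.sameBack (h : IsFresh A p i w lam r x P)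
    (hchg : ∀ y α, A' y α ≠ A y α → y = p ∨ (y ∉ support A p (depth n) ∧
      ∀ s < depth n, A' y α ∉ ball A p s)) : SameBack A A' p (depth n) := by
  intro s hs y hy α hα
  by_contra hne
  rcases hchg y α hne with rfl | ⟨h1, h2⟩
  · exact hy (self_mem_ball A y s)
  · rcases hα with hα | hα
    · exact h1 (mem_support_iff.2 (ball_mono A p hs (mem_ball_succ.2 (Or.inr ⟨α, hα⟩))))
    · exact h2 s hs hα

/-- A structure that follows fresh states and otherwise agrees with `A`. -/
theorem IsFresh.isThreadData {d₁ d₂ : ℝ} (h : IsFresh A p i w lam r x P) (hd : 1 ≤ d)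
    (hi : i < ⌈Real.sqrt n⌉₊)
    (hlam : ∀ c, 2 * Real.sqrt n ≤ lam c ∧ (lam c : ℝ) ≤ 3 * Real.sqrt n)
    (hl : ∀ c, 1 ≤ l c ∧ l c ≤ lam c) (hG : A ∈ goodBack d₁ d₂ p)
    (hchg : ∀ y α, A' y α ≠ A y α → y = p ∨ (y ∉ support A p (depth n) ∧
      ∀ s < depth n, A' y α ∉ ball A p s))
    (h0 : A' p la = r 0) (hr : ∀ k < i, A' (r (k / 2)) (lastLetter k) = r (k + 1))
    (hx : ∀ k α, (pathWord d w)[k]? = some α → A' (x k) α = x (k + 1))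
    (hP : ∀ c j, j + 1 < lam c → A' (P c j) lb = P c (j + 1))
    (hc : ∀ c, A' (P c (lam c - 1)) lb = P c (lam c - l c)) :
    IsThreadData d₁ d₂ d A' p (x 0) i w lam l x P ∧ ∀ k ≤ i, fwdState A' p k = r k := by
  have hS := h.sameBack hchg
  have hf := fwdState_eq h0 hr
  have hsucc : FwdSuccess A' p i := by
    refine ⟨fun j hj => ⟨?_, fun k hk => ?_, by omega⟩, by omega, ?_⟩
    · rw [hf j hj.le, hS.support_eq]; exact h.r_notMem j hj
    · rw [hf j hj.le, hf k (by omega)]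
      exact fun he => by have := h.r_inj j hj k (by omega) he; omega
    · rw [hf i le_rfl, hS.layer_eq le_rfl]; exact h.r_last
  have hK : ∀ y, y ∉ support A p (depth n) → (∀ k < i, y ≠ r k) → y ∉ cycleSupport A' p i := by
    rintro y h1 h2 (h3 | ⟨j, hj, h3⟩)
    · exact h1 (hS.support_eq ▸ h3)
    · exact h2 j hj (h3.trans (hf j hj.le))
  have hinj := h.thread_inj hd
  refine ⟨?_, hf⟩
  constructor
  · refine ⟨rfl, hx, h.root, h.branch, fun c => ⟨hP c, fun j j' hj hj' he =>
      (hinj c j c j' hj hj' he).2, (hl c).1, (hl c).2, hc c⟩⟩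
  · rw [goodBack, Finset.mem_filter] at hG
    refine ⟨?_, ?_, hsucc, ?_⟩
    · rw [hS.support_eq, ncard_support]; exact hG.2.1
    · rw [hS.layer_eq le_rfl, ncard_layer]; exact hG.2.2
    · obtain ⟨v, hv, hm⟩ := h.word
      refine isCycleWord_iff.2 ⟨v, hv, ?_⟩
      rw [hf i le_rfl]
      exact hS.isMinWord h.r_last hm
  · exact fun k hk => hK _ (h.x_notMem k hk) (h.x_ne_r k hk)
  · exact h.x_inj
  · exact hlam
  · exact fun c j h1 h2 => ⟨hK _ (h.P_notMem c j h1 h2) (h.P_ne_r c j h1 h2), h.P_ne_x c j h1 h2⟩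
  · exact hinj

/-- Indices of the transitions that follow fresh states. -/
abbrev SourceIndex {d : ℕ} (i m : ℕ) (lam : Fin (d + 1) → ℕ) : Type :=
  Fin (i + 1) ⊕ Fin m ⊕ (c : Fin (d + 1)) × Fin (lam c)

/-- The transitions that follow fresh states. -/
def source {d : ℕ} (p : Fin n) (i m : ℕ) (u : List Letter) (lam : Fin (d + 1) → ℕ)
    (r x : ℕ → Fin n) (P : Fin (d + 1) → ℕ → Fin n) : SourceIndex i m lam → Fin n × Letter
  | .inl ⟨0, _⟩ => (p, la)
  | .inl ⟨k + 1, _⟩ => (r (k / 2), lastLetter k)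
  | .inr (.inl k) => (x k, u.getD k la)
  | .inr (.inr ⟨c, j⟩) => (P c j, lb)

/-- The targets of the transitions that follow fresh states. -/
def target {d : ℕ} (i m : ℕ) (lam l : Fin (d + 1) → ℕ) (r x : ℕ → Fin n)
    (P : Fin (d + 1) → ℕ → Fin n) : SourceIndex i m lam → Fin n
  | .inl k => r k
  | .inr (.inl k) => x (k + 1)
  | .inr (.inr ⟨c, j⟩) => if (j : ℕ) + 1 < lam c then P c (j + 1) else P c (lam c - l c)

theorem lastLetter_eq_iff {k k' : ℕ} : lastLetter k = lastLetter k' ↔ k % 2 = k' % 2 := by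
  unfold lastLetter
  split_ifs with h1 h2 h2 <;> simp <;> omega

theorem IsFresh.source_injective (h : IsFresh A p i w lam r x P) (hd : 1 ≤ d) {m : ℕ}
    (hm : (pathWord d w).length = m) :
    Function.Injective (source p i m (pathWord d w) lam r x P) := by
  have hpr : ∀ j < i, p ≠ r j := fun j hj he => h.r_notMem j hj (he ▸ self_mem_support A p _)
  have hpx : ∀ k ≤ (pathWord d w).length, p ≠ x k := fun k hk he =>
    h.x_notMem k hk (he ▸ self_mem_support A p _)
  have hrP : ∀ k < i, ∀ c j, j < lam c → r k ≠ P c j := by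
    intro k hk c j hj he
    rcases Nat.eq_zero_or_pos j with rfl | hj0
    · rcases h.thread_zero hd c with ⟨-, h2⟩ | ⟨-, k', hk', -, h2⟩
      · exact hpr k hk (h2.symm.trans he.symm)
      · exact h.x_ne_r k' hk' k hk (h2.symm.trans he.symm)
    · exact h.P_ne_r c j hj0 hj k hk he.symm
  -- Path and threads meet only at the branching states, where the path reads a.
  have hxP : ∀ k < m, ∀ c j, j < lam c → x k = P c j → (pathWord d w).getD k la ≠ lb := by
    intro k hk c j hj he
    rcases Nat.eq_zero_or_pos j with rfl | hj0
    · rcases h.thread_zero hd c with ⟨-, h2⟩ | ⟨hc, k', hk', hk1, h2⟩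
      · exact absurd (h2.symm.trans he.symm) (hpx k (by omega))
      · obtain rfl := h.x_inj k (by omega) k' hk' (he.trans h2)
        have hc1 : 1 ≤ (c : ℕ) := Nat.one_le_iff_ne_zero.2 fun h => hc (Fin.ext h)
        have hkc : k = (c : ℕ) * (w.length + 1) - 1 := by omega
        rw [List.getD_eq_getElem?_getD, hkc, getElem?_pathWord hc1 w (by omega) hd]
        decide
    · exact absurd he.symm (h.P_ne_x c j hj0 hj k (by omega))
  rintro (⟨_ | k, hk⟩ | k | ⟨c, j⟩) (⟨_ | k', hk'⟩ | k' | ⟨c', j'⟩) he <;>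
    simp only [source, Prod.mk.injEq] at he
  · rfl
  · exact absurd he.1 (hpr _ (by omega))
  · exact absurd he.1 (hpx _ (by omega))
  · exact absurd he.2 (by decide)
  · exact absurd he.1.symm (hpr _ (by omega))
  · have h1 := h.r_inj _ (by omega) _ (by omega) he.1
    have h2 := lastLetter_eq_iff.1 he.2
    obtain rfl : k = k' := by omega
    rfl
  · exact absurd he.1.symm (h.x_ne_r _ (by omega) _ (by omega))
  · exact absurd he.1 (hrP _ (by omega) _ _ j'.2)
  · exact absurd he.1.symm (hpx _ (by omega))
  · exact absurd he.1 (h.x_ne_r _ (by omega) _ (by omega))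
  · rw [Fin.ext (h.x_inj _ (by omega) _ (by omega) he.1)]
  · exact absurd he.2 (hxP _ k.2 _ _ j'.2 he.1)
  · exact absurd he.2 (by decide)
  · exact absurd he.1.symm (hrP _ (by omega) _ _ j.2)
  · exact absurd he.2.symm (hxP _ k'.2 _ _ j.2 he.1.symm)
  · obtain ⟨rfl, h2⟩ := h.thread_inj hd _ _ _ _ j.2 j'.2 he.1
    rw [Fin.ext h2]

/-- `A` with the transitions `s j` redirected to `t j`. -/
noncomputable def overwrite {J : Type*} (A : TransStruct n) (s : J → Fin n × Letter) (t : J → Fin n) :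
    TransStruct n :=
  fun y α => Function.extend s t (fun e => A e.1 e.2) (y, α)

theorem overwrite_apply {J : Type*} {s : J → Fin n × Letter} (hs : Function.Injective s)
    (t : J → Fin n) {j : J} {y : Fin n} {α : Letter} (h : s j = (y, α)) :
    overwrite A s t y α = t j := by
  rw [overwrite, ← h, hs.extend_apply]

theorem overwrite_of_notMem {J : Type*} {s : J → Fin n × Letter} (t : J → Fin n) {y : Fin n}
    {α : Letter} (h : ¬ ∃ j, s j = (y, α)) : overwrite A s t y α = A y α :=
  Function.extend_apply' _ _ _ h

theorem IsFresh.source_fst (h : IsFresh A p i w lam r x P) (hd : 1 ≤ d) {m : ℕ}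
    (hm : (pathWord d w).length = m) (j : SourceIndex i m lam) :
    (source p i m (pathWord d w) lam r x P j).1 = p ∨
      (source p i m (pathWord d w) lam r x P j).1 ∉ support A p (depth n) := by
  rcases j with ⟨_ | k, hk⟩ | k | ⟨c, j⟩
  · exact Or.inl rfl
  · exact Or.inr (h.r_notMem _ (by omega))
  · exact Or.inr (h.x_notMem _ (by omega))
  · rcases Nat.eq_zero_or_pos (j : ℕ) with hj | hj
    · simp only [source, hj]
      rcases h.thread_zero hd c with ⟨-, h2⟩ | ⟨-, k', hk', -, h2⟩
      · exact Or.inl h2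
      · exact Or.inr (h2 ▸ h.x_notMem _ hk')
    · exact Or.inr (h.P_notMem _ _ hj j.2)

/-- The strict inequality `l c < lam c` keeps every cycle from closing at the start of its thread,
in particular at `p`. -/
theorem IsFresh.target_notMem (h : IsFresh A p i w lam r x P) {m : ℕ}
    (hm : (pathWord d w).length = m) (hl : ∀ c, 1 ≤ l c ∧ l c < lam c) (j : SourceIndex i m lam)
    {s : ℕ} (hs : s < depth n) : target i m lam l r x P j ∉ ball A p s := by
  have hball : ∀ y, y ∉ support A p (depth n) → y ∉ ball A p s := fun y hy hy' =>
    hy (mem_support_iff.2 (ball_mono A p hs.le hy'))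
  rcases j with k | k | ⟨c, j⟩
  · rcases (Nat.lt_succ_iff.1 k.2).lt_or_eq with hk | hk
    · exact hball _ (h.r_notMem _ hk)
    · simp only [target, hk]
      exact (mem_layer_iff.1 h.r_last).2 s hs
  · exact hball _ (h.x_notMem _ (by omega))
  · have := hl c
    simp only [target]
    split_ifs with hj
    · exact hball _ (h.P_notMem _ _ (by omega) hj)
    · exact hball _ (h.P_notMem _ _ (by omega) (by omega))

theorem IsFresh.isThreadData_overwrite {d₁ d₂ : ℝ} (h : IsFresh A p i w lam r x P) (hd : 1 ≤ d)
    {m : ℕ} (hm : (pathWord d w).length = m) (hi : i < ⌈Real.sqrt n⌉₊)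
    (hlam : ∀ c, 2 * Real.sqrt n ≤ lam c ∧ (lam c : ℝ) ≤ 3 * Real.sqrt n)
    (hl : ∀ c, 1 ≤ l c ∧ l c < lam c) (hG : A ∈ goodBack d₁ d₂ p) :
    IsThreadData d₁ d₂ d (overwrite A (source p i m (pathWord d w) lam r x P)
      (target i m lam l r x P)) p (x 0) i w lam l x P ∧
      ∀ k ≤ i, fwdState (overwrite A (source p i m (pathWord d w) lam r x P)
        (target i m lam l r x P)) p k = r k := by
  have hs := h.source_injective hd hm
  refine h.isThreadData hd hi hlam (fun c => ⟨(hl c).1, (hl c).2.le⟩) hG (fun y α hne => ?_)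
    ?_ ?_ ?_ ?_ ?_
  · by_cases he : ∃ j, source p i m (pathWord d w) lam r x P j = (y, α)
    · obtain ⟨j, hj⟩ := he
      rw [overwrite_apply hs _ hj]
      have := h.source_fst hd hm j
      rw [hj] at this
      exact this.imp_right fun h1 => ⟨h1, fun s hs => h.target_notMem hm hl j hs⟩
    · exact absurd (overwrite_of_notMem _ he) hne
  · exact overwrite_apply hs _ (j := .inl ⟨0, by omega⟩) rfl
  · intro k hk
    exact overwrite_apply hs _ (j := .inl ⟨k + 1, by omega⟩) rfl
  · intro k α hk
    obtain ⟨hk1, hk2⟩ := List.getElem?_eq_some_iff.1 hk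
    refine overwrite_apply hs _ (j := .inr (.inl ⟨k, by omega⟩)) ?_
    simp only [source, List.getD_eq_getElem?_getD, hk, Option.getD_some]
  · intro c j hj
    refine (overwrite_apply hs _ (j := .inr (.inr ⟨c, ⟨j, by omega⟩⟩)) rfl).trans ?_
    simp only [target, if_pos hj]
  · intro c
    have := hl c
    refine (overwrite_apply hs _ (j := .inr (.inr ⟨c, ⟨lam c - 1, by omega⟩⟩)) rfl).trans ?_
    simp only [target]
    rw [if_neg (by omega)]

end Fresh

/-! ### Counting the choices of fresh states -/

/-- Indices of the fresh states. -/
abbrev FreshIndex {d : ℕ} (i m : ℕ) (lam : Fin (d + 1) → ℕ) : Type :=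
  Fin i ⊕ Fin (m + 1) ⊕ (c : Fin (d + 1)) × Fin (lam c - 1)

section Fresh

variable {d i m : ℕ} {lam l : Fin (d + 1) → ℕ}

/-- The forward states given by `z`, followed by `y`. -/
def freshFwd (z : FreshIndex i m lam → Fin n) (y : Fin n) (k : ℕ) : Fin n :=
  if h : k < i then z (.inl ⟨k, h⟩) else y

/-- The path given by `z`. -/
def freshPath (z : FreshIndex i m lam → Fin n) (p : Fin n) (k : ℕ) : Fin n :=
  if h : k < m + 1 then z (.inr (.inl ⟨k, h⟩)) else p

/-- The threads given by `z`. -/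
def freshThread (z : FreshIndex i m lam → Fin n) (p : Fin n) (W : ℕ) (c : Fin (d + 1)) :
    ℕ → Fin n
  | 0 => if c = 0 then p else freshPath z p ((c : ℕ) * W - 1)
  | j + 1 => if h : j < lam c - 1 then z (.inr (.inr ⟨c, ⟨j, h⟩⟩)) else p

open Classical in
/-- The length-lexicographically smallest word that leads from `y` to `p`, if there is one. -/
noncomputable def minWord (A : TransStruct n) (p y : Fin n) : List Letter :=
  if h : ∃ v, IsMinWord A p y v then h.choose else []

theorem isMinWord_minWord {A : TransStruct n} {p y : Fin n} {h : ℕ} (hy : y ∈ layer A p h) :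
    IsMinWord A p y (minWord A p y) := by
  have hex := exists_isMinWord (mem_layer_iff.1 hy).1
  rw [minWord, dif_pos hex]
  exact hex.choose_spec

theorem freshFwd_of_lt (z : FreshIndex i m lam → Fin n) (y : Fin n) {k : ℕ} (hk : k < i) :
    freshFwd z y k = z (.inl ⟨k, hk⟩) := dif_pos hk

theorem freshFwd_last (z : FreshIndex i m lam → Fin n) (y : Fin n) : freshFwd z y i = y :=
  dif_neg (lt_irrefl i)

theorem freshPath_of_le (z : FreshIndex i m lam → Fin n) (p : Fin n) {k : ℕ} (hk : k ≤ m) :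
    freshPath z p k = z (.inr (.inl ⟨k, Nat.lt_succ_iff.2 hk⟩)) := dif_pos (Nat.lt_succ_iff.2 hk)

theorem freshThread_of_lt (z : FreshIndex i m lam → Fin n) (p : Fin n) (W : ℕ) {c : Fin (d + 1)}
    {j : ℕ} (hj1 : 1 ≤ j) (hj : j < lam c) :
    freshThread z p W c j = z (.inr (.inr ⟨c, ⟨j - 1, by omega⟩⟩)) := by
  obtain ⟨j, rfl⟩ := Nat.exists_eq_add_of_le' hj1
  rw [freshThread, dif_pos (by omega)]
  rfl

theorem isFresh_of_injective {A : TransStruct n} {p y : Fin n} {w : List Letter}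
    {z : FreshIndex i m lam → Fin n} (hz : Function.Injective z)
    (hzb : ∀ ι, z ι ∉ ball A p (depth n)) (hy : y ∈ layer A p (depth n))
    (hw : w = wordAt i ++ minWord A p y) (hm : (pathWord d w).length = m) :
    IsFresh A p i w lam (freshFwd z y) (freshPath z p) (freshThread z p (w.length + 1)) := by
  have hzs : ∀ ι, z ι ∉ support A p (depth n) := fun ι h => hzb ι (mem_support_iff.1 h)
  subst hm
  constructor
  · intro j hj
    rw [freshFwd_of_lt _ _ hj]
    exact hzs _
  · intro j hj k hk he
    rw [freshFwd_of_lt _ _ hj, freshFwd_of_lt _ _ hk] at he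
    simpa using hz he
  · rwa [freshFwd_last]
  · rw [freshFwd_last]
    exact ⟨_, hw, isMinWord_minWord hy⟩
  · intro k hk
    rw [freshPath_of_le _ _ hk]
    exact hzs _
  · intro k hk j hj he
    rw [freshPath_of_le _ _ hk, freshFwd_of_lt _ _ hj] at he
    simpa using hz he
  · intro k hk j hj he
    rw [freshPath_of_le _ _ hk, freshPath_of_le _ _ hj] at he
    simpa using hz he
  · simp [freshThread]
  · intro c hc
    simp [freshThread, hc]
  · intro c j h1 h2
    rw [freshThread_of_lt _ _ _ h1 h2]
    exact hzs _
  · intro c j h1 h2 k hk he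
    rw [freshThread_of_lt _ _ _ h1 h2, freshFwd_of_lt _ _ hk] at he
    simpa using hz he
  · intro c j h1 h2 k hk he
    rw [freshThread_of_lt _ _ _ h1 h2, freshPath_of_le _ _ hk] at he
    simpa using hz he
  · intro c j c' j' h1 h1' h2 h2' he
    rw [freshThread_of_lt _ _ _ h1 h2, freshThread_of_lt _ _ _ h1' h2'] at he
    have he' := hz he
    simp only [Sum.inr.injEq, Sigma.mk.injEq] at he'
    obtain ⟨rfl, h3⟩ := he'
    have := congrArg Fin.val (eq_of_heq h3)
    simp only at this
    exact ⟨rfl, by omega⟩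

theorem freshIndex_ext {z z' : FreshIndex i m lam → Fin n} {y y' p : Fin n} {W : ℕ}
    (h1 : ∀ k ≤ i, freshFwd z y k = freshFwd z' y' k)
    (h2 : ∀ k ≤ m, freshPath z p k = freshPath z' p k)
    (h3 : ∀ c, ∀ j < lam c, freshThread z p W c j = freshThread z' p W c j) :
    z = z' ∧ y = y' := by
  constructor
  · funext ι
    rcases ι with k | k | ⟨c, j⟩
    · have := h1 k k.2.le
      rwa [freshFwd_of_lt _ _ k.2, freshFwd_of_lt _ _ k.2] at this
    · have := h2 k (Nat.lt_succ_iff.1 k.2)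
      rwa [freshPath_of_le _ _ (Nat.lt_succ_iff.1 k.2),
        freshPath_of_le _ _ (Nat.lt_succ_iff.1 k.2)] at this
    · have hj : (j : ℕ) + 1 < lam c := by omega
      have := h3 c (j + 1) hj
      rwa [freshThread_of_lt _ _ _ (by omega) hj, freshThread_of_lt _ _ _ (by omega) hj] at this
  · have := h1 i le_rfl
    rwa [freshFwd_last, freshFwd_last] at this

open Classical in
/-- The pairs `(q, A)` with a forward process, threads and cycles of given lengths. -/
noncomputable def threadPairs (d₁ d₂ : ℝ) (d : ℕ) (p : Fin n) (i : ℕ) (lam l : Fin (d + 1) → ℕ) :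
    Finset (Fin n × TransStruct n) :=
  Finset.univ.filter fun ω => ∃ w x P, IsThreadData d₁ d₂ d ω.2 p ω.1 i w lam l x P

open Classical in
/-- The choices of fresh states that avoid the backward support of `A`. -/
noncomputable def freshChoices (A : TransStruct n) (p : Fin n) (i m : ℕ)
    (lam : Fin (d + 1) → ℕ) : Finset (FreshIndex i m lam → Fin n) :=
  Finset.univ.filter fun z => Function.Injective z ∧ ∀ ι, z ι ∉ ball A p (depth n)

theorem descFactorial_le_card_freshChoices (A : TransStruct n) (p : Fin n) (i m : ℕ)
    (lam : Fin (d + 1) → ℕ) :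
    (n - (ball A p (depth n)).card).descFactorial (Fintype.card (FreshIndex i m lam)) ≤
      (freshChoices A p i m lam).card := by
  classical
  have hc : Fintype.card {x // x ∉ ball A p (depth n)} = n - (ball A p (depth n)).card := by
    rw [Fintype.card_subtype_compl, Fintype.card_fin, Fintype.card_coe]
  rw [← hc, ← Fintype.card_embedding_eq, ← Finset.card_univ]
  refine Finset.card_le_card_of_injOn (fun f ι => (f ι : Fin n)) (fun f _ => ?_) ?_
  · rw [freshChoices, Finset.coe_filter]
    exact ⟨Finset.mem_univ _, fun a b h => f.injective (Subtype.ext h), fun ι => (f ι).2⟩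
  · intro f _ g _ h
    ext ι
    exact congrArg Fin.val (congrFun h ι)

/-- The value of m does not depend on `A`, because the minimal word from the last layer always has
length `depth n`. The factor n^|SourceIndex| pays for recording the overwritten values. -/
theorem card_sigma_le_card_threadPairs {d₁ d₂ : ℝ} (hd : 1 ≤ d) (p : Fin n)
    (hm : m + 1 = d * ((wordAt i).length + depth n + 1)) (hi : i < ⌈Real.sqrt n⌉₊)
    (hlam : ∀ c, 2 * Real.sqrt n ≤ lam c ∧ (lam c : ℝ) ≤ 3 * Real.sqrt n)
    (hl : ∀ c, 1 ≤ l c ∧ l c < lam c) :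
    ((goodBack d₁ d₂ p).sigma fun A => (ball A p (depth n) \ inner A p (depth n)) ×ˢ
      freshChoices A p i m lam).card ≤
      (threadPairs d₁ d₂ d p i lam l).card * n ^ Fintype.card (SourceIndex i m lam) := by
  classical
  have hcard : n ^ Fintype.card (SourceIndex i m lam) =
      (Finset.univ : Finset (SourceIndex i m lam → Fin n)).card := by
    rw [Finset.card_univ, Fintype.card_fun, Fintype.card_fin]
  rw [hcard, ← Finset.card_product]
  set word : TransStruct n → Fin n → List Letter := fun A y => wordAt i ++ minWord A p y
   
  set src : TransStruct n → Fin n → (FreshIndex i m lam → Fin n) → SourceIndex i m lam →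
    Fin n × Letter := fun A y z => source p i m (pathWord d (word A y)) lam (freshFwd z y)
      (freshPath z p) (freshThread z p ((word A y).length + 1)) with hsrc
  set ovw : TransStruct n → Fin n → (FreshIndex i m lam → Fin n) → TransStruct n :=
    fun A y z => overwrite A (src A y z) (target i m lam l (freshFwd z y) (freshPath z p)
      (freshThread z p ((word A y).length + 1))) with h_ovw
  have key : ∀ A y z, A ∈ goodBack d₁ d₂ p → y ∈ ball A p (depth n) \ inner A p (depth n) →
      z ∈ freshChoices A p i m lam → (pathWord d (word A y)).length = m ∧
        Function.Injective (src A y z) ∧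
        IsThreadData d₁ d₂ d (ovw A y z) p (freshPath z p 0) i (word A y) lam l (freshPath z p)
          (freshThread z p ((word A y).length + 1)) ∧
        ∀ k ≤ i, fwdState (ovw A y z) p k = freshFwd z y k := by
    intro A y z hA hy hz
    rw [freshChoices, Finset.mem_filter] at hz
    have hy' : y ∈ layer A p (depth n) := by
      rw [← coe_ball_sdiff_inner]
      exact Finset.mem_coe.2 hy
    have hlen : (pathWord d (word A y)).length = m := by
      have := length_pathWord hd (wordAt i ++ minWord A p y)
      rw [List.length_append, (isMinWord_minWord hy').length_eq hy', ← hm] at this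
      exact Nat.succ_injective this
    have hF := isFresh_of_injective (lam := lam) hz.2.1 hz.2.2 hy' rfl hlen
    exact ⟨hlen, hF.source_injective hd hlen, hF.isThreadData_overwrite hd hlen hi hlam hl hA⟩
  refine Finset.card_le_card_of_injOn
    (fun τ => ((freshPath τ.2.2 p 0, ovw τ.1 τ.2.1 τ.2.2),
      fun j => τ.1 (src τ.1 τ.2.1 τ.2.2 j).1 (src τ.1 τ.2.1 τ.2.2 j).2)) ?_ ?_
  · rintro ⟨A, y, z⟩ hτ
    rw [Finset.mem_coe, Finset.mem_sigma, Finset.mem_product] at hτ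
    rw [Finset.mem_coe, Finset.mem_product, threadPairs, Finset.mem_filter]
    exact ⟨⟨Finset.mem_univ _, _, _, _, (key A y z hτ.1 hτ.2.1 hτ.2.2).2.2.1⟩, Finset.mem_univ _⟩
  · rintro ⟨A, y, z⟩ hτ ⟨A', y', z'⟩ hτ' he
    rw [Finset.mem_coe, Finset.mem_sigma, Finset.mem_product] at hτ hτ'
    simp only [Prod.mk.injEq] at he
    obtain ⟨⟨hq, hA⟩, hold⟩ := he
    obtain ⟨hlen, hinj, hT, hf⟩ := key A y z hτ.1 hτ.2.1 hτ.2.2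
    obtain ⟨hlen', hinj', hT', hf'⟩ := key A' y' z' hτ'.1 hτ'.2.1 hτ'.2.2
    rw [← hA, ← hq] at hT'
    rw [← hA] at hf'
    -- Uniqueness in the overwritten structure recovers the fresh states and the forward states,
    -- hence the list of overwritten transitions; the recorded values then give back `A`.
    obtain ⟨-, hw, -, -, hx, hP⟩ := hT.unique hd hT'
    rw [← hw] at hP
    obtain ⟨rfl, rfl⟩ := freshIndex_ext (fun k hk => (hf k hk).symm.trans (hf' k hk))
      (fun k hk => hx k (by omega)) hP
    have hs : src A y z = src A' y z := by simp only [hsrc, hw]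
    obtain rfl : A = A' := by
      funext s α
      by_cases hj : ∃ j, src A y z j = (s, α)
      · obtain ⟨j, hj⟩ := hj
        have := congrFun hold j
        rwa [← hs, hj] at this
      · have := congrFun (congrFun hA s) α
        simp only [h_ovw] at this
        rwa [overwrite_of_notMem _ hj, overwrite_of_notMem _ (by rwa [← hs])] at this
    rfl

/-- Compared with fresh states, the forward process has one more transition (into r_i), the path one
fewer (its start is q), and each thread one more. -/
theorem card_sourceIndex (hlam : ∀ c, 1 ≤ lam c) :
    Fintype.card (SourceIndex i m lam) = Fintype.card (FreshIndex i m lam) + (d + 1) := by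
  have : ∑ c, lam c = ∑ c, (lam c - 1) + (d + 1) := by
    rw [← Finset.sum_congr rfl fun c _ => Nat.sub_add_cancel (hlam c), Finset.sum_add_distrib]
    simp
  simp only [Fintype.card_sum, Fintype.card_fin, Fintype.card_sigma, this]
  omega

theorem card_goodBack_mul_le {d₁ d₂ K : ℝ} (hd : 1 ≤ d) (p : Fin n)
    (hm : m + 1 = d * ((wordAt i).length + depth n + 1)) (hi : i < ⌈Real.sqrt n⌉₊)
    (hlam : ∀ c, 2 * Real.sqrt n ≤ lam c ∧ (lam c : ℝ) ≤ 3 * Real.sqrt n)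
    (hl : ∀ c, 1 ≤ l c ∧ l c < lam c)
    (hK : d₁ * Real.sqrt n + Fintype.card (FreshIndex i m lam) ≤ K * Real.sqrt n)
    (hKn : K * Real.sqrt n ≤ n) :
    (goodBack d₁ d₂ p).card * (d₂ * Real.sqrt n) *
        (n - K * Real.sqrt n) ^ Fintype.card (FreshIndex i m lam) ≤
      (threadPairs d₁ d₂ d p i lam l).card *
        (n : ℝ) ^ (Fintype.card (FreshIndex i m lam) + (d + 1)) := by
  set k := Fintype.card (FreshIndex i m lam)
  have h1 : (((goodBack d₁ d₂ p).sigma fun A => (ball A p (depth n) \ inner A p (depth n)) ×ˢ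
      freshChoices A p i m lam).card : ℝ) ≤ _ :=
    Nat.cast_le.2 (card_sigma_le_card_threadPairs (d₁ := d₁) (d₂ := d₂) hd p hm hi hlam hl)
  rw [card_sourceIndex fun c => by have := hl c; omega] at h1
  push_cast at h1
  refine le_trans ?_ h1
  rw [Finset.card_sigma, Nat.cast_sum, mul_assoc, ← nsmul_eq_mul]
  refine Finset.card_nsmul_le_sum _ _ _ fun A hA => ?_
  rw [goodBack, Finset.mem_filter] at hA
  obtain ⟨-, hA1, hA2⟩ := hA
  rw [Finset.card_product, Nat.cast_mul]
  have hs := Real.sqrt_nonneg n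
  refine mul_le_mul hA2 ?_ (pow_nonneg (by linarith) _) (by positivity)
  refine le_trans ?_ (Nat.cast_le.2 (descFactorial_le_card_freshChoices A p i m lam))
  refine le_trans ?_ (Nat.cast_le.2 (Nat.pow_sub_le_descFactorial _ _))
  rw [Nat.cast_pow]
  refine pow_le_pow_left₀ (by linarith) ?_ _
  have h2 : (ball A p (depth n)).card + k ≤ n := by
    have : ((ball A p (depth n)).card : ℝ) + k ≤ n := by linarith
    exact_mod_cast this
  have h3 : n - (ball A p (depth n)).card + 1 - k = n + 1 - ((ball A p (depth n)).card + k) := by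
    omega
  rw [h3, Nat.cast_sub (by omega)]
  push_cast
  linarith

end Fresh

/-! ### The lower bound for the probability of success -/

theorem two_pow_length_wordAt_le (k : ℕ) : 2 ^ (wordAt k).length ≤ k + 1 := by
  induction k using Nat.strong_induction_on with
  | _ k ih =>
    cases k with
    | zero => simp [wordAt]
    | succ k =>
      rw [wordAt_succ, List.length_append, List.length_singleton, pow_succ]
      have := ih (k / 2) (by omega)
      omega

theorem length_wordAt_le_depth (hn : 0 < n) {i : ℕ} (hi : i < ⌈Real.sqrt n⌉₊) :
    (wordAt i).length ≤ depth n := by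
  have h1 : ⌈Real.sqrt n⌉₊ ≤ 2 ^ depth n := by
    rw [Nat.ceil_le]
    exact_mod_cast sqrt_le_two_pow_depth hn
  have h2 := two_pow_length_wordAt_le i
  exact (Nat.pow_le_pow_iff_right (by norm_num)).1 (h2.trans ((Nat.succ_le_of_lt hi).trans h1))

theorem sq_le_two_pow {k : ℕ} (hk : 4 ≤ k) : k ^ 2 ≤ 2 ^ k := by
  induction k, hk using Nat.le_induction with
  | base => norm_num
  | succ k hk ih =>
    rw [pow_succ 2 k]
    nlinarith

/-- Both `wordAt i` and the minimal word have length at most h = `depth n`, and h ≥ 6 d + 4 gives 6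
d h ≤ h^2 ≤ 2^h ≤ 2 √n. -/
theorem path_length_le_sqrt {d : ℕ} (hn : 4 ^ (6 * d + 4) ≤ n) {i : ℕ}
    (hi : i < ⌈Real.sqrt n⌉₊) :
    ((d * ((wordAt i).length + depth n + 1) : ℕ) : ℝ) ≤ Real.sqrt n := by
  have hn0 : 0 < n := lt_of_lt_of_le (by positivity) hn
  have hnR : (0 : ℝ) ≤ n := by positivity
  have hdep : 6 * d + 4 ≤ depth n := by
    have h1 : (2 : ℝ) ^ (6 * d + 4) ≤ Real.sqrt n := by
      rw [Real.le_sqrt (by positivity) hnR, ← pow_mul, mul_comm, pow_mul]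
      norm_num
      exact_mod_cast hn
    have h2 : 2 ^ (6 * d + 4) ≤ 2 ^ depth n := by
      exact_mod_cast h1.trans (sqrt_le_two_pow_depth hn0)
    exact (Nat.pow_le_pow_iff_right (by norm_num)).1 h2
  have h1 := length_wordAt_le_depth hn0 hi
  have h2 := sq_le_two_pow (k := depth n) (by omega)
  have h3 : 2 * (d * ((wordAt i).length + depth n + 1)) ≤ 2 ^ depth n := by
    refine le_trans ?_ h2
    have h4 : (wordAt i).length + depth n + 1 ≤ 3 * depth n := by omega
    have h5 := Nat.mul_le_mul_left (2 * d) h4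
    have h6 := Nat.mul_le_mul_right (depth n) (show 6 * d ≤ depth n by omega)
    nlinarith
  have h4 : 2 * ((d * ((wordAt i).length + depth n + 1) : ℕ) : ℝ) ≤ 2 ^ depth n := by
    exact_mod_cast h3
  linarith [two_pow_depth_le hn0]

/-- For t ≤ 1/2, (1 - t) (1 + 2 t) ≥ 1, so 1 - t ≥ exp (-2 t). -/
theorem exp_neg_le_pow {K s : ℝ} (hK : 0 < K) (hs : 2 * K ≤ s) {k : ℕ} (hk : (k : ℝ) ≤ K * s) :
    Real.exp (-(2 * K ^ 2)) ≤ (1 - K / s) ^ k := by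
  have hs0 : 0 < s := by linarith
  set t := K / s with ht
  have ht0 : 0 < t := by positivity
  have ht1 : t ≤ 1 / 2 := by rw [ht, div_le_iff₀ hs0]; linarith
  have h1 : Real.exp (-(2 * t)) ≤ 1 - t := by
    rw [Real.exp_neg]
    have h2 := Real.add_one_le_exp (2 * t)
    refine (inv_anti₀ (by positivity) h2).trans ?_
    rw [inv_le_iff_one_le_mul₀ (by positivity)]
    nlinarith
  refine le_trans ?_ (pow_le_pow_left₀ (Real.exp_pos _).le h1 k)
  rw [← Real.exp_nat_mul, Real.exp_le_exp]
  have h3 : t * k ≤ K ^ 2 := by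
    calc t * k ≤ t * (K * s) := by gcongr
      _ = K ^ 2 := by rw [ht]; field_simp
  linarith

/-- The lengths of threads used in the lower bound. -/
noncomputable def threadLengths (n : ℕ) : Finset ℕ :=
  Finset.Ioc ⌊2 * Real.sqrt n⌋₊ ⌊3 * Real.sqrt n⌋₊

/-- The lengths of cycles. -/
noncomputable def cycleLengths (n : ℕ) : Finset ℕ :=
  Finset.Icc ⌈Real.sqrt n⌉₊ ⌊2 * Real.sqrt n⌋₊

theorem coe_cycleLengths (n : ℕ) : (cycleLengths n : Set ℕ) = loopRange n := by
  ext m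
  rw [cycleLengths, Finset.coe_Icc, Set.mem_Icc, Nat.ceil_le, Nat.le_floor_iff (by positivity)]
  rfl

theorem finite_loopRange (n : ℕ) : (loopRange n).Finite := by
  rw [← coe_cycleLengths]
  exact Finset.finite_toSet _

theorem mem_threadLengths {m : ℕ} (hm : m ∈ threadLengths n) :
    2 * Real.sqrt n < m ∧ (m : ℝ) ≤ 3 * Real.sqrt n := by
  rw [threadLengths, Finset.mem_Ioc] at hm
  exact ⟨Nat.lt_of_floor_lt hm.1, (Nat.le_floor_iff (by positivity)).1 hm.2⟩

theorem half_sqrt_le_card_threadLengths (hs : 2 ≤ Real.sqrt n) :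
    Real.sqrt n / 2 ≤ (threadLengths n).card := by
  rw [threadLengths, Nat.card_Ioc, Nat.cast_sub (Nat.floor_le_floor (by linarith))]
  have h1 := Nat.lt_floor_add_one (3 * Real.sqrt n)
  have h2 := Nat.floor_le (a := 2 * Real.sqrt n) (by positivity)
  linarith

theorem half_sqrt_le_card_cycleLengths (hs : 2 ≤ Real.sqrt n) :
    Real.sqrt n / 2 ≤ (cycleLengths n).card := by
  have h1 := Nat.lt_floor_add_one (2 * Real.sqrt n)
  have h2 := Nat.ceil_lt_add_one (Real.sqrt_nonneg n)
  have h3 : ⌈Real.sqrt n⌉₊ ≤ ⌊2 * Real.sqrt n⌋₊ + 1 := by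
    have : (⌈Real.sqrt n⌉₊ : ℝ) ≤ (⌊2 * Real.sqrt n⌋₊ + 1 : ℕ) := by push_cast; linarith
    exact_mod_cast this
  rw [cycleLengths, Nat.card_Icc, Nat.cast_sub h3]
  push_cast
  linarith

/-- The number of steps of the forward process, the thread lengths and the cycle lengths. -/
noncomputable def lengthData (n d : ℕ) :
    Finset (ℕ × (Fin (d + 1) → ℕ) × (Fin (d + 1) → ℕ)) :=
  Finset.range ⌈Real.sqrt n⌉₊ ×ˢ (Fintype.piFinset fun _ => threadLengths n) ×ˢ
    Fintype.piFinset fun _ => cycleLengths n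

theorem le_card_lengthData (hs : 2 ≤ Real.sqrt n) (d : ℕ) :
    Real.sqrt n * (n / 4) ^ (d + 1) ≤ (lengthData n d).card := by
  rw [lengthData, Finset.card_product, Finset.card_product, Finset.card_range,
    Fintype.card_piFinset, Fintype.card_piFinset]
  simp only [Finset.prod_const, Finset.card_univ, Fintype.card_fin]
  push_cast
  have e : (n : ℝ) / 4 = Real.sqrt n / 2 * (Real.sqrt n / 2) := by
    nlinarith [Real.mul_self_sqrt (Nat.cast_nonneg (α := ℝ) n)]
  rw [e, mul_pow]
  gcongr
  · exact Nat.le_ceil _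
  · exact half_sqrt_le_card_threadLengths hs
  · exact half_sqrt_le_card_cycleLengths hs

/-- The events are disjoint because (q, A) determines i, the thread lengths and the cycle lengths.
-/
theorem sum_card_threadPairs_le {d₁ d₂ : ℝ} {d : ℕ} (hd : 1 ≤ d) (p : Fin n) :
    ∑ σ ∈ lengthData n d, (threadPairs d₁ d₂ d p σ.1 σ.2.1 σ.2.2).card ≤
      (successEvent d₁ d₂ d p).ncard := by
  classical
  rw [← Finset.card_biUnion, ← Set.ncard_coe_finset]
  · refine Set.ncard_le_ncard (fun ω hω => ?_) (Set.toFinite _)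
    rw [Finset.mem_coe, Finset.mem_biUnion] at hω
    obtain ⟨σ, hσ, hω⟩ := hω
    rw [threadPairs, Finset.mem_filter] at hω
    obtain ⟨-, w, x, P, hT⟩ := hω
    rw [lengthData, Finset.mem_product, Finset.mem_product, Fintype.mem_piFinset,
      Fintype.mem_piFinset] at hσ
    have hl : ∀ i, σ.2.2 i ∈ loopRange n := fun i => by
      rw [← coe_cycleLengths]
      exact hσ.2.2 i
    have h := (loopLengths_eq_some_iff hd).2 ⟨hT.isLoopTuple, hl⟩
    change loopLengths d₁ d₂ d ω.2 p ω.1 ≠ none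
    rw [h]
    exact Option.some_ne_none _
  · intro σ _ σ' _ hne
    rw [Function.onFun, Finset.disjoint_left]
    intro ω hω hω'
    rw [threadPairs, Finset.mem_filter] at hω hω'
    obtain ⟨-, w, x, P, hT⟩ := hω
    obtain ⟨-, w', x', P', hT'⟩ := hω'
    obtain ⟨h1, -, h2, h3, -⟩ := hT.unique hd hT'
    exact hne (Prod.ext h1 (Prod.ext h2 h3))

theorem card_freshIndex_le {d i m : ℕ} {lam : Fin (d + 1) → ℕ} (hi : i < ⌈Real.sqrt n⌉₊)
    (hm : ((m + 1 : ℕ) : ℝ) ≤ Real.sqrt n) (hlam : ∀ c, (lam c : ℝ) ≤ 3 * Real.sqrt n) :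
    (Fintype.card (FreshIndex i m lam) : ℝ) ≤ (3 * d + 5) * Real.sqrt n := by
  simp only [Fintype.card_sum, Fintype.card_fin, Fintype.card_sigma, Nat.cast_add, Nat.cast_sum]
  have h1 : (i : ℝ) ≤ Real.sqrt n := (Nat.lt_ceil.1 hi).le
  have h2 : ∑ c, ((lam c - 1 : ℕ) : ℝ) ≤ ∑ _c : Fin (d + 1), 3 * Real.sqrt n :=
    Finset.sum_le_sum fun c _ => le_trans (by exact_mod_cast Nat.sub_le _ _) (hlam c)
  rw [Finset.sum_const, Finset.card_univ, Fintype.card_fin, nsmul_eq_mul] at h2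
  push_cast at h2 hm ⊢
  linarith

theorem le_card_threadPairs {d : ℕ} (hd : 1 ≤ d) (hn : 4 ^ (6 * d + 4) ≤ n)
    (hs : 2 * (3 * d + 261 : ℝ) ≤ Real.sqrt n) (p : Fin n)
    {σ : ℕ × (Fin (d + 1) → ℕ) × (Fin (d + 1) → ℕ)} (hσ : σ ∈ lengthData n d) :
    (goodBack 256 (1 / 4) p).card * (1 / 4 * Real.sqrt n) *
      Real.exp (-(2 * (3 * d + 261 : ℝ) ^ 2)) / (n : ℝ) ^ (d + 1) ≤
      (threadPairs 256 (1 / 4) d p σ.1 σ.2.1 σ.2.2).card := by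
  obtain ⟨i, lam, l⟩ := σ
  rw [lengthData, Finset.mem_product, Finset.mem_product, Fintype.mem_piFinset,
    Fintype.mem_piFinset, Finset.mem_range] at hσ
  obtain ⟨hi, hlam, hl⟩ := hσ
  simp only at hi hlam hl ⊢
  -- In units of √n: 256 for the backward ball, 1 for the forward states, 1 for the path and 3 (d +
  -- 1) for the threads.
  set K : ℝ := 3 * d + 261 with hKdef
  have hK0 : 0 < K := by positivity
  have hs0 : 0 < Real.sqrt n := by linarith
  have hnR : (0 : ℝ) < n := by exact_mod_cast p.pos
  have hsq : Real.sqrt n * Real.sqrt n = n := Real.mul_self_sqrt hnR.le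
  obtain ⟨m, hm⟩ : ∃ m, m + 1 = d * ((wordAt i).length + depth n + 1) :=
    ⟨_, Nat.sub_add_cancel (Nat.mul_pos hd (Nat.succ_pos _))⟩
  have hlam' := fun c => mem_threadLengths (hlam c)
  have hk := card_freshIndex_le (d := d) (i := i) (m := m) hi
    (by rw [hm]; exact path_length_le_sqrt hn hi) fun c => (hlam' c).2
  set k := Fintype.card (FreshIndex i m lam) with hkdef
  -- The lengths in `threadLengths` exceed 2 √n strictly, which gives the strict inequality needed
  -- for overwriting.
  have hl' : ∀ c, 1 ≤ l c ∧ l c < lam c := fun c => by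
    have h1 : l c ∈ loopRange n := by rw [← coe_cycleLengths]; exact hl c
    have h2 : (1 : ℝ) ≤ l c := (one_le_sqrt_of_state p).trans h1.1
    have h3 : (l c : ℝ) < lam c := h1.2.trans_lt (hlam' c).1
    exact ⟨by exact_mod_cast h2, by exact_mod_cast h3⟩
  have key := card_goodBack_mul_le (d₁ := 256) (d₂ := 1 / 4) (K := K) hd p hm hi
    (fun c => ⟨(hlam' c).1.le, (hlam' c).2⟩) hl' (by rw [← hkdef]; linarith) (by nlinarith)
  rw [← hkdef, pow_add, ← mul_assoc] at key
  have e : (n : ℝ) - K * Real.sqrt n = (1 - K / Real.sqrt n) * n := by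
    have e' : (n : ℝ) / Real.sqrt n = Real.sqrt n := by rw [div_eq_iff hs0.ne', hsq]
    rw [sub_mul, one_mul, div_mul_eq_mul_div, mul_div_assoc, e']
  rw [e, mul_pow] at key
  have hexp := exp_neg_le_pow hK0 hs (k := k) (by nlinarith)
  have hnk : (0 : ℝ) < (n : ℝ) ^ k := by positivity
  rw [div_le_iff₀ (by positivity)]
  have h1 : (goodBack 256 (1 / 4) p).card * (1 / 4 * Real.sqrt n) *
      (1 - K / Real.sqrt n) ^ k ≤
      (threadPairs 256 (1 / 4) d p i lam l).card * (n : ℝ) ^ (d + 1) := by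
    refine le_of_mul_le_mul_right ?_ hnk
    linarith
  refine le_trans ?_ h1
  gcongr

theorem le_ncard_successEvent {d : ℕ} (hd : 1 ≤ d) (hn0 : 2 ^ 14 ≤ n) (hn : 4 ^ (6 * d + 4) ≤ n)
    (hs : 2 * (3 * d + 261 : ℝ) ≤ Real.sqrt n) (p : Fin n) :
    Real.exp (-(2 * (3 * d + 261 : ℝ) ^ 2)) / (256 * 4 ^ (d + 1)) *
      (n * Fintype.card (TransStruct n)) ≤ ((successEvent 256 (1 / 4) d p).ncard : ℝ) := by
  have hG := card_transStruct_le_card_goodBack hn0 p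
  set κ := Real.exp (-(2 * (3 * d + 261 : ℝ) ^ 2))
  have hκ : 0 < κ := Real.exp_pos _
  set M : ℝ := (Fintype.card (TransStruct n) : ℝ)
  have hnR : (0 : ℝ) < n := by exact_mod_cast p.pos
  have hsq : Real.sqrt n * Real.sqrt n = n := Real.mul_self_sqrt hnR.le
  have h2 : 2 ≤ Real.sqrt n := by
    have : (0 : ℝ) ≤ d := by positivity
    linarith
  have hsum := Finset.card_nsmul_le_sum (lengthData n d) _ _ fun σ hσ =>
    le_card_threadPairs hd hn hs p hσ
  have htot : ∑ σ ∈ lengthData n d,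
      ((threadPairs 256 (1 / 4) d p σ.1 σ.2.1 σ.2.2).card : ℝ) ≤
      (successEvent 256 (1 / 4) d p).ncard := by
    exact_mod_cast sum_card_threadPairs_le (d₁ := 256) (d₂ := 1 / 4) hd p
  refine le_trans ?_ (hsum.trans htot)
  rw [nsmul_eq_mul]
  have hcard := le_card_lengthData h2 d
  calc κ / (256 * 4 ^ (d + 1)) * (n * M)
      = Real.sqrt n * (n / 4) ^ (d + 1) *
          (M / 64 * (1 / 4 * Real.sqrt n) * κ / (n : ℝ) ^ (d + 1)) := by
        rw [div_pow]
        field_simp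
        nlinarith
    _ ≤ _ := by gcongr

theorem randomPair_eq (p : Fin n) :
    randomPair n = uniformOn (Set.univ : Set (Fin n × TransStruct n)) := by
  have : Nonempty (Fin n) := ⟨p⟩
  exact uniformOn_univ_prod

theorem randomPair_real (p : Fin n) (E : Set (Fin n × TransStruct n)) :
    (randomPair n).real E = (E.ncard : ℝ) / (n * Fintype.card (TransStruct n)) := by
  rw [randomPair_eq p, Measure.real, uniformOn_apply_eq_ncard, Set.univ_inter, Set.ncard_univ,
    Nat.card_eq_fintype_card, Fintype.card_prod, Fintype.card_fin]
  simp

/-! ### The law of the cycle lengths -/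

theorem mem_loopRange_of_mem_successEvent {d₁ d₂ : ℝ} {d : ℕ} (hd : 1 ≤ d) {p : Fin n}
    {ω : Fin n × TransStruct n} (hω : ω ∈ successEvent d₁ d₂ d p) (i : Fin (d + 1)) :
    loopLength d₁ d₂ d ω.2 p ω.1 i ∈ loopRange n := by
  obtain ⟨l, hl⟩ := Option.ne_none_iff_exists'.1 hω
  rw [loopLength, hl]
  exact ((loopLengths_eq_some_iff hd).1 hl).2 i

theorem successEvent_inter_eq {d₁ d₂ : ℝ} {d : ℕ} (p : Fin n) (g : Fin (d + 1) → ℕ) :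
    successEvent d₁ d₂ d p ∩ {ω | ∀ i, loopLength d₁ d₂ d ω.2 p ω.1 i = g i} =
      {ω | loopLengths d₁ d₂ d ω.2 p ω.1 = some g} := by
  ext ω
  constructor
  · rintro ⟨h1, h2⟩
    obtain ⟨l, hl⟩ := Option.ne_none_iff_exists'.1 h1
    change loopLengths d₁ d₂ d ω.2 p ω.1 = some g
    rw [hl]
    congr 1
    funext i
    have := h2 i
    rwa [loopLength, hl] at this
  · intro h
    have h' : loopLengths d₁ d₂ d ω.2 p ω.1 = some g := h
    refine ⟨?_, fun i => ?_⟩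
    · change loopLengths d₁ d₂ d ω.2 p ω.1 ≠ none
      rw [h']
      exact Option.some_ne_none _
    · rw [loopLength, h']
      rfl

theorem iIndepFun_and_map_loopLength {d₁ d₂ : ℝ} {d : ℕ} (hd : 1 ≤ d) (p : Fin n)
    (hne : (successEvent d₁ d₂ d p).Nonempty) :
    iIndepFun (fun (i : Fin (d + 1)) (ω : Fin n × TransStruct n) =>
        loopLength d₁ d₂ d ω.2 p ω.1 i) ((randomPair n)[|successEvent d₁ d₂ d p]) ∧
      ∀ i : Fin (d + 1), ((randomPair n)[|successEvent d₁ d₂ d p]).map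
        (fun ω => loopLength d₁ d₂ d ω.2 p ω.1 i) = uniformOn (loopRange n) := by
  rw [randomPair_eq p, cond_uniformOn_univ]
  refine iIndepFun_and_map_of_ncard_eq hne (finite_loopRange n)
    (fun ω hω i => mem_loopRange_of_mem_successEvent hd hω i) fun g g' _ hg' => ?_
  rw [successEvent_inter_eq, successEvent_inter_eq]
  exact ncard_loopLengths_le hd p hg'

end RandomAutomaton

/-! ### Conclusion. -/

theorem mainTheorem4 :
    ∃ d₁ d₂ : ℝ, 0 < d₁ ∧ 0 < d₂ ∧
      ∀ d : ℕ, 1 ≤ d → ∃ c : ℝ, 0 < c ∧ ∃ N : ℕ, ∀ n : ℕ, N ≤ n → ∀ p : Fin n,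
        c ≤ (RandomAutomaton.randomPair n).real (RandomAutomaton.successEvent d₁ d₂ d p) ∧
        ProbabilityTheory.iIndepFun
          (fun (i : Fin (d + 1)) (ω : Fin n × RandomAutomaton.TransStruct n) =>
            RandomAutomaton.loopLength d₁ d₂ d ω.2 p ω.1 i)
          (ProbabilityTheory.cond (RandomAutomaton.randomPair n)
            (RandomAutomaton.successEvent d₁ d₂ d p)) ∧
        ∀ i : Fin (d + 1),
          MeasureTheory.Measure.map
            (fun ω : Fin n × RandomAutomaton.TransStruct n =>
              RandomAutomaton.loopLength d₁ d₂ d ω.2 p ω.1 i)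
            (ProbabilityTheory.cond (RandomAutomaton.randomPair n)
              (RandomAutomaton.successEvent d₁ d₂ d p)) =
          ProbabilityTheory.uniformOn (RandomAutomaton.loopRange n) := by
  refine ⟨256, 1 / 4, by norm_num, by norm_num, fun d hd =>
    ⟨Real.exp (-(2 * (3 * d + 261 : ℝ) ^ 2)) / (256 * 4 ^ (d + 1)), by positivity,
      2 ^ 14 + 4 ^ (6 * d + 4) + (2 * (3 * d + 261)) ^ 2, fun n hn p => ?_⟩⟩
  have hs : 2 * (3 * d + 261 : ℝ) ≤ Real.sqrt n := by
    rw [Real.le_sqrt (by positivity) (by positivity)]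
    have : (2 * (3 * d + 261)) ^ 2 ≤ n := le_trans (Nat.le_add_left _ _) hn
    exact_mod_cast this
  have hn' : 2 ^ 14 + 4 ^ (6 * d + 4) ≤ n := le_trans (Nat.le_add_right _ _) hn
  have hle := RandomAutomaton.le_ncard_successEvent hd (le_trans (Nat.le_add_right _ _) hn')
    (le_trans (Nat.le_add_left _ _) hn') hs p
  have hM : (0 : ℝ) < n * Fintype.card (RandomAutomaton.TransStruct n) := by
    have h1 : 0 < n := p.pos
    have h2 : 0 < Fintype.card (RandomAutomaton.TransStruct n) :=
      Fintype.card_pos_iff.2 ⟨fun _ _ => p⟩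
    exact_mod_cast Nat.mul_pos h1 h2
  -- The counting bound also shows that the conditioning event is non-empty, so that the conditional
  -- law is a probability measure.
  have hne : (RandomAutomaton.successEvent 256 (1 / 4) d p).Nonempty := by
    refine Set.nonempty_of_ncard_ne_zero fun h0 => ?_
    rw [h0, Nat.cast_zero] at hle
    exact absurd hle (not_le.2 (by positivity))
  refine ⟨?_, RandomAutomaton.iIndepFun_and_map_loopLength hd p hne⟩
  rw [RandomAutomaton.randomPair_real p, le_div_iff₀ hM]
  exact hle
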